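/- Setting. For each integer $n\ge 1$ let $G_n=(V_n,E_n,(c_{xy})_{xy\in E_n})$ be a finite connected undirected graph with $|V_n|=n$ and conductances $c_{xy}=c_{yx}>0$, and let $\pi=\pi_n$ be a probability on $V_n$ with $\pi(x)>0$ for all $x$. The dependence on $n$ is mostly omitted. Put $\|\psi\|_p=\big(\sum_x\pi(x)|\psi(x)|^p\big)^{1/p}$ for $1\le p<\infty$, and let $\Delta$ be the set of probability distributions on $V_n$. The single-particle chain has generator $$L\psi(z)=\sum_{xy\in E}c_{xy}\big(P_{xy}\psi(z)-\psi(z)\big),\qquad P_{xy}\psi(z)=\begin{cases}\frac{\pi(x)\psi(x)+\pi(y)\psi(y)}{\pi(x)+\pi(y)}&\text{if } z\in\{x,y\},\\ \psi(z)&\text{otherwise,}\end{cases}$$ and Dirichlet form $\mathcal E(\psi)=\sum_{xy\in E}c_{xy}\frac{\pi(x)\pi(y)}{\pi(x)+\pi(y)}(\psi(x)-\psi(y))^2$. Its spectral gap is $$\mathrm{gap}=\inf\Big\{\tfrac{\sum_x\pi(x)\psi(x)(-L\psi)(x)}{\sum_x\pi(x)\psi(x)^2}:\ \psi\ne0,\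 \sum_x\pi(x)\psi(x)=0\Big\},$$ and $t_{\rm rel}=\mathrm{gap}^{-1}$ is the relaxation time. The Averaging process $(\eta_t)_{t\ge0}$ is the Markov process on $\Delta$ with generator $f\mapsto\sum_{xy\in E}c_{xy}\big(f(\eta^{xy})-f(\eta)\big)$, where $\eta^{xy}(x)=\frac{\pi(x)}{\pi(x)+\pi(y)}(\eta(x)+\eta(y))$, $\eta^{xy}(y)=\frac{\pi(y)}{\pi(x)+\pi(y)}(\eta(x)+\eta(y))$ and $\eta^{xy}(z)=\eta(z)$ for $z\notin\{x,y\}$. Write $\mathbb E_\eta$ for the expectation when the process starts from $\eta\in\Delta$. Assumptions. (1) Finite-dimensional geometries: there are positive $d=d(n)$, $T=T(n)$, $t_{\rm Nash}=t_{\rm Nash}(n)$ such that, for every $n$ and every $\psi:V_n\to\mathbb R$, $$\|\psi\|_2^{2(1+2/d)}\le t_{\rm Nash}\big(\mathcal E(\psi)+T^{-1}\|\psi\|_2^2\big)\|\psi\|_1^{4/d},$$ and, as $n\to\infty$, $d=O(1)$, $t_{\rm Nash}=O(t_{\rm rel})$ and $T=\Theta(t_{\rm Nash})$. (2) Uniform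 ellipticity: there is $c_{\rm ell}\in[1,\infty)$ with $\max_x\pi(x)\le c_{\rm ell}\min_x\pi(x)$ for every $n$. (3) $k=k_n$ is a sequence of natural numbers with $k\to\infty$ and $k=O(n^2)$. Theorem (Cutoff on a finer scale). Let $t^\pm(C)=\frac{t_{\rm rel}}2\log k\pm C\,t_{\rm rel}$. Under (1)--(3), for every $\delta\in(0,1)$ there exists $C>0$, independent of $n$ and $p$, such that for all $p\in[1,2]$ $$\limsup_{n\to\infty}\sqrt k\,\sup_{\eta\in\Delta}\mathbb E_\eta\Big[\Big\|\frac{\eta_{t^+(C)}}{\pi}-1\Big\|_p\Big]\le\delta,\qquad \liminf_{n\to\infty}\sqrt k\,\sup_{\eta\in\Delta}\mathbb E_\eta\Big[\Big\|\frac{\eta_{t^-(C)}}{\pi}-1\Big\|_p\Big]\ge\frac1\delta .$$ -/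

import Mathlib

open Filter Topology Asymptotics

noncomputable section

/-- The semigroup `exp(t A)` generated by a bounded operator `A` on a normed space. -/
def expSemigroup {E : Type*} [NormedAddCommGroup E] [NormedSpace ℝ E] (A : E →L[ℝ] E) (t : ℝ) :
    E →L[ℝ] E :=
  NormedSpace.exp (t • A)

/-- A finite connected undirected graph on `V` with positive conductances on its edges, together
with non-degenerate site-weights, i.e. a probability `wt` (written `π` in the literature) on `V`
with `wt x > 0` for every `x`. The conductance of a pair that is not an edge is `0`. -/
structure WeightedGraph (V : Type*) [Fintype V] where
  graph : SimpleGraph V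
  connected : graph.Connected
  cond : V → V → ℝ
  cond_symm : ∀ x y, cond x y = cond y x
  cond_pos : ∀ x y, graph.Adj x y → 0 < cond x y
  cond_eq_zero : ∀ x y, ¬ graph.Adj x y → cond x y = 0
  wt : V → ℝ
  wt_pos : ∀ x, 0 < wt x
  sum_wt : ∑ x, wt x = 1

namespace WeightedGraph

variable {V : Type*} [Fintype V]

/-- The sum `∑_{xy ∈ E} c_{xy} F(x, y)` over unordered edges, for `F` symmetric in `x` and `y`:
one half of the sum over ordered pairs. -/
def edgeSum {A : Type*} [AddCommGroup A] [Module ℝ A] (G : WeightedGraph V) (F : V → V → A) : A :=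
  (1 / 2 : ℝ) • ∑ x, ∑ y, G.cond x y • F x y

/-- The norm of `L^p(V, π)`, for finite `p`. -/
def lpNorm (G : WeightedGraph V) (p : ℝ) (ψ : V → ℝ) : ℝ :=
  (∑ x, G.wt x * |ψ x| ^ p) ^ (1 / p)

section SingleParticle

variable [DecidableEq V]

/-- A particle which sits at `x` or `y` is placed at `x` with probability `π(x) / (π(x) + π(y))`
and at `y` otherwise; a particle elsewhere does not move. -/
def resample (G : WeightedGraph V) (x y : V) (ψ : V → ℝ) : V → ℝ := fun z =>
  if z = x ∨ z = y then
    G.wt x / (G.wt x + G.wt y) * ψ x + G.wt y / (G.wt x + G.wt y) * ψ y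
  else ψ z

/-- The generator of the single-particle Binomial Splitting process. -/
def binGenerator (G : WeightedGraph V) (ψ : V → ℝ) : V → ℝ :=
  G.edgeSum fun x y => G.resample x y ψ - ψ

/-- The spectral gap of the single-particle system, through the Rayleigh quotient. -/
def gap (G : WeightedGraph V) : ℝ :=
  sInf {r : ℝ | ∃ ψ : V → ℝ, ψ ≠ 0 ∧ ∑ x, G.wt x * ψ x = 0 ∧
    r = (∑ x, G.wt x * (ψ x * (-G.binGenerator ψ x))) / ∑ x, G.wt x * ψ x ^ 2}

/-- The relaxation time. -/
def tRel (G : WeightedGraph V) : ℝ := G.gap⁻¹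

end SingleParticle

/-- The Dirichlet form of the single-particle system. -/
def dirichletForm (G : WeightedGraph V) (ψ : V → ℝ) : ℝ :=
  G.edgeSum fun x y => G.wt x * G.wt y / (G.wt x + G.wt y) * (ψ x - ψ y) ^ 2

/-- The Nash inequality for the single-particle system with constants `d`, `tNash`, `T`. -/
def Nash (G : WeightedGraph V) (d tNash T : ℝ) : Prop :=
  ∀ ψ : V → ℝ, G.lpNorm 2 ψ ^ (2 * (1 + 2 / d)) ≤
    tNash * (G.dirichletForm ψ + T⁻¹ * G.lpNorm 2 ψ ^ 2) * G.lpNorm 1 ψ ^ (4 / d)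

section Averaging

variable [DecidableEq V]

/-- The configuration `η^{xy}`: the total mass at `x` and `y` is redistributed between `x` and `y`
proportionally to their site-weights. -/
def splitFun (G : WeightedGraph V) (x y : V) (η : V → ℝ) : V → ℝ := fun z =>
  if z = x then G.wt x / (G.wt x + G.wt y) * (η x + η y)
  else if z = y then G.wt y / (G.wt x + G.wt y) * (η x + η y)
  else η z

theorem splitFun_mem (G : WeightedGraph V) (x y : V) {η : V → ℝ} (hη : η ∈ stdSimplex ℝ V) :
    G.splitFun x y η ∈ stdSimplex ℝ V := by
  have hx := G.wt_pos x
  have hy := G.wt_pos y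
  refine ⟨fun z => ?_, ?_⟩
  · have h1 := hη.1 x
    have h2 := hη.1 y
    have h3 := hη.1 z
    unfold splitFun
    split_ifs <;> positivity
  · rw [← hη.2]
    by_cases hxy : x = y
    · subst hxy
      refine Finset.sum_congr rfl fun z _ => ?_
      unfold splitFun
      split_ifs with h
      · subst h
        field_simp
      · rfl
    · have key : ∀ f : V → ℝ, ∑ z, f z = f x + (f y + ∑ z ∈ (Finset.univ.erase x).erase y, f z) := by
        intro f
        rw [Finset.add_sum_erase _ _ (by simp [Ne.symm hxy]),
          Finset.add_sum_erase _ _ (Finset.mem_univ x)]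
      rw [key, key η]
      have hrest : ∑ z ∈ (Finset.univ.erase x).erase y, G.splitFun x y η z
          = ∑ z ∈ (Finset.univ.erase x).erase y, η z := by
        refine Finset.sum_congr rfl fun z hz => ?_
        simp only [Finset.mem_erase, Finset.mem_univ, and_true] at hz
        simp [splitFun, hz.1, hz.2]
      rw [hrest]
      simp only [splitFun, if_true, if_neg (Ne.symm hxy)]
      field_simp
      ring

/-- `η ↦ η^{xy}` as a continuous self-map of the simplex `Δ` of probabilities on `V`. -/
def split (G : WeightedGraph V) (x y : V) : C(stdSimplex ℝ V, stdSimplex ℝ V) where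
  toFun η := ⟨G.splitFun x y η.1, G.splitFun_mem x y η.2⟩
  continuous_toFun := by
    refine Continuous.subtype_mk (continuous_pi fun z => ?_) _
    have h : ∀ w, Continuous fun η : stdSimplex ℝ V => η.1 w :=
      fun w => (continuous_apply w).comp continuous_subtype_val
    unfold splitFun
    split_ifs
    · exact continuous_const.mul ((h x).add (h y))
    · exact continuous_const.mul ((h x).add (h y))
    · exact h z

/-- The generator of the Averaging process, the bounded operator
`f ↦ ∑_{xy ∈ E} c_{xy} (f(η^{xy}) - f(η))` on the Banach space `C(Δ)`. -/
def avgGenerator (G : WeightedGraph V) : C(stdSimplex ℝ V, ℝ) →L[ℝ] C(stdSimplex ℝ V, ℝ) :=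
  G.edgeSum fun x y => ContinuousMap.compCLM ℝ ℝ (G.split x y) - ContinuousLinearMap.id ℝ _

/-- The Feller semigroup `S_t = exp(t L)` of the Averaging process, which is the Markov process on
`Δ` with generator `L`. -/
def avgSemigroup (G : WeightedGraph V) (t : ℝ) :
    C(stdSimplex ℝ V, ℝ) →L[ℝ] C(stdSimplex ℝ V, ℝ) :=
  expSemigroup G.avgGenerator t

/-- The expectation `E_η[f(η_t)] = (S_t f)(η)` for the Averaging process started from `η`. -/
def avgExpect (G : WeightedGraph V) (η : stdSimplex ℝ V) (t : ℝ) (f : C(stdSimplex ℝ V, ℝ)) : ℝ :=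
  G.avgSemigroup t f η

end Averaging

/-- The observable `η ↦ ‖η / π - 1‖_p` on the simplex. -/
def lpDist (G : WeightedGraph V) (p : ℝ) (hp : 0 ≤ p) : C(stdSimplex ℝ V, ℝ) where
  toFun η := G.lpNorm p fun x => η.1 x / G.wt x - 1
  continuous_toFun := by
    have h : ∀ w, Continuous fun η : stdSimplex ℝ V => η.1 w :=
      fun w => (continuous_apply w).comp continuous_subtype_val
    unfold lpNorm
    refine Continuous.rpow_const ?_ fun _ => Or.inr (by positivity)
    refine continuous_finsetSum _ fun x _ => continuous_const.mul ?_
    exact Continuous.rpow_const (((h x).div_const _).sub continuous_const).abs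
      fun _ => Or.inr hp

/-- The worst-case distance to equilibrium `sup_{η ∈ Δ} E_η[‖η_t / π - 1‖_p]`. -/
def avgWorstDist [DecidableEq V] (G : WeightedGraph V) (p : ℝ) (hp : 0 ≤ p) (t : ℝ) : ℝ :=
  ⨆ η : stdSimplex ℝ V, G.avgExpect η t (G.lpDist p hp)

/-- The time `t_mix + s * t_rel`, where `t_mix = (t_rel / 2) log k`. -/
def cutoffTime [DecidableEq V] (G : WeightedGraph V) (k : ℕ) (s : ℝ) : ℝ :=
  G.tRel / 2 * Real.log k + s * G.tRel

end WeightedGraph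

/-- Finite-dimensional geometries: Nash inequalities hold with positive constants such that
`d = O(1)`, `tNash = O(t_rel)` and `T = Θ(tNash)`. -/
def FiniteDimensionalGeometry {V : ℕ+ → Type*} [∀ n, Fintype (V n)] [∀ n, DecidableEq (V n)]
    (G : ∀ n, WeightedGraph (V n)) : Prop :=
  ∃ d tNash T : ℕ+ → ℝ,
    (∀ n, 0 < d n ∧ 0 < tNash n ∧ 0 < T n ∧ (G n).Nash (d n) (tNash n) (T n)) ∧
    d =O[atTop] (fun _ => (1 : ℝ)) ∧
    tNash =O[atTop] (fun n => (G n).tRel) ∧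
    T =Θ[atTop] tNash

/-- Uniformly elliptic site-weights: `max π / min π` is bounded uniformly in `n`. -/
def UniformlyElliptic {V : ℕ+ → Type*} [∀ n, Fintype (V n)]
    (G : ∀ n, WeightedGraph (V n)) : Prop :=
  ∃ cEll : ℝ, 1 ≤ cEll ∧ ∀ n x y, (G n).wt x ≤ cEll * (G n).wt y

end

/-!
Write `h_t = η_t / π - 1`, `γ = gap` and `w(t) = E ‖h_t‖₂²`. The generator of the Averaging
process maps the quadratic observable `‖exp(rL) h‖₂²` to its derivative in `r` plus the noise
`noise r = ∑ c_{xy} ‖exp(rL) (P_{xy} h - h)‖₂²`. Hence `s ↦ E ‖exp((t-s)L) h_s‖₂²` has derivative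
`E [noise (t-s)]`, while `w' = -E [noise 0] = -E ℰ(h)`.

The vectors `P_{xy} h - h` are multiples of dipoles `(δ_x - δ_y) / π`. Nash's inequality and
Jensen's inequality give `u' ≤ A u - B u ^ (1 + 2/d)` for `u = w + 1`, so that `w(t_rel / 4)` is
of order one, and by Jensen so is the squared norm of `exp((t_rel / 4) L) (δ_x - δ_y) / π`,
whereas the dipole itself has squared norm at least `2 / max π`.
Thus `noise r ≤ κ exp(-2γr) noise 0` for `r ≥ t_rel / 4`, with `κ` of order `max π`, and
integrating gives, for `b = t_rel / 4`,
`E ‖exp(bL) h_{t-b}‖₂² ≤ (exp(-2γt) + 2κ exp(-γt)) w(0)`. Since `noise r ≤ noise 0` for all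
`r ≥ 0`, one has `2 w(t) ≤ w(t - b) + E ‖exp(bL) h_{t-b}‖₂²`, and iterating this transfers the
bound to `w`. As `√k max π = O(1)`, restarting at time `t_rel / 4`, where `w` is of order one,
makes `w` of order `exp(-C) / k` at time `(t_rel / 2) log k + C t_rel`.

For the lower bound, the same smoothing bounds an eigenfunction `ψ` for the spectral gap by a
constant multiple of its `L²` norm. Starting from `η` with `η / π - 1 = ψ / ‖ψ‖_∞`, the mean
`E ⟨ψ, h_t⟩` decays exactly like `exp(-γt)`, and it is at most `‖ψ‖_∞ E ‖h_t‖_p`.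
-/

section ExpSemigroup

variable {E : Type*} [NormedAddCommGroup E] [NormedSpace ℝ E] (A : E →L[ℝ] E)

theorem expSemigroup_zero : expSemigroup A 0 = 1 := by
  simp [expSemigroup]

theorem expSemigroup_apply_comm (t : ℝ) (f : E) :
    expSemigroup A t (A f) = A (expSemigroup A t f) :=
  congrArg (fun B : E →L[ℝ] E => B f) ((Commute.refl A).smul_left t).exp_left.eq

variable [CompleteSpace E]

theorem expSemigroup_add (s t : ℝ) :
    expSemigroup A (s + t) = expSemigroup A s * expSemigroup A t := by
  let _ : NormedAlgebra ℚ (E →L[ℝ] E) := NormedAlgebra.restrictScalars ℚ ℝ _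
  unfold expSemigroup
  rw [add_smul, NormedSpace.exp_add_of_commute]
  exact (Commute.refl A).smul_left s |>.smul_right t

theorem hasDerivAt_expSemigroup (t : ℝ) :
    HasDerivAt (expSemigroup A) (A * expSemigroup A t) t := by
  refine (hasDerivAt_exp_smul_const A t).congr_deriv ?_
  ext f
  exact expSemigroup_apply_comm A t f

variable {A}

theorem hasDerivAt_expSemigroup_apply {g : ℝ → E} {g' : E} {t : ℝ} (hg : HasDerivAt g g' t) :
    HasDerivAt (fun s => expSemigroup A s (g s)) (expSemigroup A t (A (g t) + g')) t :=
  ((hasDerivAt_expSemigroup A t).clm_apply hg).congr_deriv <| by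
    rw [map_add, expSemigroup_apply_comm]; rfl

theorem expSemigroup_apply_of_eigenvector {f : E} {μ : ℝ} (hf : A f = μ • f) (t : ℝ) :
    expSemigroup A t f = Real.exp (t * μ) • f := by
  have hderiv : ∀ s, HasDerivAt (fun s => expSemigroup A s (Real.exp (-(s * μ)) • f)) 0 s := by
    intro s
    refine (hasDerivAt_expSemigroup_apply
      ((((hasDerivAt_id s).mul_const μ).neg).exp.smul_const f)).congr_deriv ?_
    rw [map_smul, hf, ← map_zero (expSemigroup A s)]
    congr 1
    simp only [id_eq]
    module
  have hconst := is_const_of_deriv_eq_zero (fun s => (hderiv s).differentiableAt)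
    (fun s => (hderiv s).deriv) t 0
  simp only [map_smul, zero_mul, neg_zero, Real.exp_zero, one_smul, expSemigroup_zero,
    one_apply_eq_self] at hconst
  conv_rhs => rw [← hconst]
  rw [smul_smul, ← Real.exp_add, add_neg_cancel, Real.exp_zero, one_smul]

theorem expSemigroup_apply_eq_of_symmetric {B : E →L[ℝ] E →L[ℝ] ℝ}
    (hA : ∀ f g, B (A f) g = B f (A g)) (t : ℝ) (f g : E) :
    B (expSemigroup A t f) g = B f (expSemigroup A t g) := by
  have hflow : ∀ (h : E) (s : ℝ),
      HasDerivAt (fun s => expSemigroup A s h) (A (expSemigroup A s h)) s := fun h s => by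
    simpa [expSemigroup_apply_comm] using
      hasDerivAt_expSemigroup_apply (A := A) (hasDerivAt_const s h)
  have hderiv : ∀ s, HasDerivAt
      (fun s => B (expSemigroup A s f) (expSemigroup A (t - s) g)) 0 s := fun s => by
    refine (B.hasDerivAt_of_bilinear (fun _ => hflow f s) fun _ =>
      (hflow g (t - s)).comp_const_sub t s).congr_deriv ?_
    rw [hA, map_neg, neg_add_cancel]
  have hconst := is_const_of_deriv_eq_zero (fun s => (hderiv s).differentiableAt)
    (fun s => (hderiv s).deriv) t 0
  simpa [expSemigroup_zero] using hconst

theorem expSemigroup_nonneg [PartialOrder E] [IsOrderedAddMonoid E] [PosSMulMono ℝ E]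
    [OrderClosedTopology E] {c : ℝ} (hA : ∀ f : E, 0 ≤ f → 0 ≤ A f + c • f) {t : ℝ} (ht : 0 ≤ t)
    {f : E} (hf : 0 ≤ f) : 0 ≤ expSemigroup A t f := by
  let _ : NormedAlgebra ℚ (E →L[ℝ] E) := NormedAlgebra.restrictScalars ℚ ℝ _
  set B : E →L[ℝ] E := A + c • 1 with hB
  have hpow : ∀ n : ℕ, 0 ≤ (B ^ n) f := by
    intro n
    induction n with
    | zero => simpa using hf
    | succ n ih =>
      rw [pow_succ']
      simpa [hB] using hA _ ih
  have hsplit : expSemigroup A t = Real.exp (-(t * c)) • NormedSpace.exp (t • B) := by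
    have hsum : t • A = t • B + algebraMap ℝ (E →L[ℝ] E) (-(t * c)) := by
      rw [Algebra.algebraMap_eq_smul_one, hB]
      module
    rw [expSemigroup, hsum, NormedSpace.exp_add_of_commute (Algebra.commutes _ _).symm,
      ← NormedSpace.algebraMap_exp_comm, Algebra.algebraMap_eq_smul_one, mul_smul_comm, mul_one,
      Real.exp_eq_exp_ℝ]
  have hseries := (NormedSpace.exp_series_hasSum_exp' (𝕂 := ℝ) (t • B)).mapL
    (ContinuousLinearMap.apply ℝ E f)
  rw [hsplit, smul_apply]
  refine smul_nonneg (Real.exp_pos _).le (hseries.nonneg fun n => ?_)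
  simp only [ContinuousLinearMap.apply_apply, smul_pow, smul_apply]
  exact smul_nonneg (by positivity) (smul_nonneg (by positivity) (hpow n))

end ExpSemigroup

instance continuousMapOrderClosedTopology {X : Type*} [TopologicalSpace X] :
    OrderClosedTopology C(X, ℝ) where
  isClosed_le' := by
    simp only [ContinuousMap.le_def, Set.ofPred_forall]
    exact isClosed_iInter fun x => isClosed_le
      ((continuous_eval_const x).comp continuous_fst)
      ((continuous_eval_const x).comp continuous_snd)

section DifferentialInequalities

variable {u u' : ℝ → ℝ} {a b : ℝ}

theorem antitoneOn_Icc_of_hasDerivAt_nonpos (hu : ∀ s ∈ Set.Icc a b, HasDerivAt u (u' s) s)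
    (hle : ∀ s ∈ Set.Icc a b, u' s ≤ 0) : AntitoneOn u (Set.Icc a b) :=
  antitoneOn_of_hasDerivWithinAt_nonpos (convex_Icc a b)
    (fun s hs => (hu s hs).continuousAt.continuousWithinAt)
    (fun s hs => (hu s (interior_subset hs)).hasDerivWithinAt)
    fun s hs => hle s (interior_subset hs)

theorem le_exp_mul_of_hasDerivAt_le {l : ℝ} (hb : 0 ≤ b)
    (hu : ∀ s ∈ Set.Icc 0 b, HasDerivAt u (u' s) s)
    (hle : ∀ s ∈ Set.Icc 0 b, u' s ≤ -l * u s) : u b ≤ Real.exp (-(l * b)) * u 0 := by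
  have h := le_gronwallBound_of_liminf_deriv_right_le (K := -l) (ε := 0)
    (fun s hs => (hu s hs).continuousAt.continuousWithinAt)
    (fun s hs r hr => (hu s (Set.Ico_subset_Icc_self hs)).hasDerivWithinAt.liminf_right_slope_le hr)
    le_rfl (fun s hs => by simpa using hle s (Set.Ico_subset_Icc_self hs))
    b (Set.right_mem_Icc.mpr hb)
  rw [gronwallBound_ε0] at h
  convert h using 1
  ring_nf

theorem rpow_le_of_hasDerivAt_le_neg_rpow {c α : ℝ} (hc : 0 < c) (hα : 0 < α) (hb : 0 < b)
    (hpos : ∀ s ∈ Set.Icc 0 b, 0 < u s) (hu : ∀ s ∈ Set.Icc 0 b, HasDerivAt u (u' s) s)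
    (hle : ∀ s ∈ Set.Icc 0 b, u' s ≤ -c * u s ^ (1 + α)) : u b ^ α ≤ (α * c * b)⁻¹ := by
  have hanti : AntitoneOn (fun s => α * c * s - u s ^ (-α)) (Set.Icc 0 b) := by
    refine antitoneOn_Icc_of_hasDerivAt_nonpos (fun s hs =>
      ((hasDerivAt_id s).const_mul (α * c)).sub ((hu s hs).rpow_const (Or.inl (hpos s hs).ne')))
      fun s hs => ?_
    have hpow : u s ^ (1 + α) * u s ^ (-α - 1) = 1 := by
      rw [← Real.rpow_add (hpos s hs), show 1 + α + (-α - 1) = 0 by ring, Real.rpow_zero]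
    have hmul := mul_le_mul_of_nonneg_right (hle s hs)
      (mul_nonneg hα.le (Real.rpow_nonneg (hpos s hs).le (-α - 1)))
    linear_combination hmul - c * α * hpow
  have hb0 : (0 : ℝ) ∈ Set.Icc 0 b := Set.left_mem_Icc.mpr hb.le
  have hbb : b ∈ Set.Icc 0 b := Set.right_mem_Icc.mpr hb.le
  have h := hanti hb0 hbb hb.le
  have h0 : 0 ≤ u 0 ^ (-α) := Real.rpow_nonneg (hpos 0 hb0).le _
  simp only [mul_zero] at h
  rw [le_inv_comm₀ (Real.rpow_pos_of_pos (hpos b hbb) α) (by positivity),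
    ← Real.rpow_neg (hpos b hbb).le]
  linarith

theorem rpow_le_max_of_hasDerivAt_le {A B α : ℝ} (hB : 0 < B) (hα : 0 < α) (hb : 0 < b)
    (hpos : ∀ s ∈ Set.Icc 0 b, 0 < u s) (hu : ∀ s ∈ Set.Icc 0 b, HasDerivAt u (u' s) s)
    (hanti : AntitoneOn u (Set.Icc 0 b))
    (hle : ∀ s ∈ Set.Icc 0 b, B * u' s ≤ A * u s - u s ^ (1 + α)) :
    u b ^ α ≤ max (2 * A) (2 * B / (α * b)) := by
  rw [le_max_iff, or_iff_not_imp_left, not_le]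
  intro hlarge
  have hbb : b ∈ Set.Icc 0 b := Set.right_mem_Icc.mpr hb.le
  have h := rpow_le_of_hasDerivAt_le_neg_rpow (c := (2 * B)⁻¹) (by positivity) hα hb hpos hu
    fun s hs => by
      have hs2 : 2 * A ≤ u s ^ α := hlarge.le.trans
        (Real.rpow_le_rpow (hpos b hbb).le (hanti hs hbb hs.2) hα.le)
      have hlin := mul_le_mul_of_nonneg_left hs2 (hpos s hs).le
      have hpow : u s ^ (1 + α) = u s * u s ^ α := by
        rw [Real.rpow_add (hpos s hs), Real.rpow_one]
      rw [neg_mul, le_neg, inv_mul_le_iff₀ (by positivity)]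
      linarith [hle s hs]
  refine h.trans_eq ?_
  field_simp

theorem le_mul_of_two_mul_le_add {f g : ℝ → ℝ} {A ρ : ℝ} (hb : 0 < b) (hA : 0 ≤ A)
    (hAρ : A * ρ + 1 ≤ 2 * A) (hg : ∀ t, 0 ≤ t → 0 ≤ g t)
    (hgρ : ∀ t, b ≤ t → g (t - b) ≤ ρ * g t) (hinit : ∀ t, 0 ≤ t → t < b → f t ≤ A * g t)
    (hf : ∀ t, b ≤ t → 2 * f t ≤ f (t - b) + g t) {t : ℝ} (ht : 0 ≤ t) : f t ≤ A * g t := by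
  obtain ⟨N, hN⟩ := exists_nat_gt (t / b)
  rw [div_lt_iff₀ hb] at hN
  induction N generalizing t with
  | zero => simp only [Nat.cast_zero, zero_mul] at hN; linarith
  | succ N ih =>
    rcases lt_or_ge t b with htb | hbt
    · exact hinit t ht htb
    · have hprev := ih (t := t - b) (by linarith) (by push_cast at hN; linarith)
      have hstep := mul_le_mul_of_nonneg_left (hgρ t hbt) hA
      have hcoef := mul_le_mul_of_nonneg_right hAρ (hg t ht)
      linarith [hf t hbt]

end DifferentialInequalities

theorem tangent_le_rpow {p l u : ℝ} (hp : 1 ≤ p) (hl : 0 < l) (hu : 0 ≤ u) :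
    l ^ p + p * l ^ (p - 1) * (u - l) ≤ u ^ p := by
  have h := one_add_mul_self_le_rpow_one_add (s := u / l - 1)
    (by linarith [div_nonneg hu hl.le]) hp
  rw [add_sub_cancel, Real.div_rpow hu hl.le, le_div_iff₀ (Real.rpow_pos_of_pos hl _)] at h
  refine le_trans (le_of_eq ?_) h
  rw [Real.rpow_sub_one hl.ne']
  field_simp

theorem abs_rpow_le_of_monotone {X : Type*} [TopologicalSpace X] {φ : C(X, ℝ) →L[ℝ] ℝ}
    (hφ : Monotone φ) (hφ1 : φ 1 = 1) {p : ℝ} (hp : 1 ≤ p) {f g : C(X, ℝ)}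
    (hfg : ∀ x, |f x| ^ p ≤ g x) : |φ f| ^ p ≤ φ g := by
  rcases eq_or_ne (φ f) 0 with h0 | h0
  · rw [h0, abs_zero, Real.zero_rpow (by linarith), ← map_zero φ]
    exact hφ fun x => (Real.rpow_nonneg (abs_nonneg _) p).trans (hfg x)
  set l := |φ f|
  have hl : 0 < l := abs_pos.mpr h0
  have hl_le : l ≤ φ |f| :=
    abs_le.mpr ⟨by simpa using neg_le_neg (hφ (neg_le_abs f)), hφ (le_abs_self f)⟩
  have htangent : (l ^ p - p * l ^ (p - 1) * l) • (1 : C(X, ℝ)) + (p * l ^ (p - 1)) • |f| ≤ g := by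
    refine ContinuousMap.le_def.mpr fun x => ?_
    have hx := (tangent_le_rpow hp hl (abs_nonneg (f x))).trans (hfg x)
    simp only [ContinuousMap.add_apply, ContinuousMap.smul_apply, ContinuousMap.one_apply,
      ContinuousMap.abs_apply, smul_eq_mul]
    linarith
  have h := hφ htangent
  rw [map_add, map_smul, map_smul, hφ1, smul_eq_mul, smul_eq_mul] at h
  have hcoef : 0 ≤ p * l ^ (p - 1) := by positivity
  linarith [mul_le_mul_of_nonneg_left hl_le hcoef]

theorem exp_half_le : Real.exp (1 / 2) ≤ 5 / 3 := by
  have hsq : Real.exp (1 / 2) ^ 2 = Real.exp 1 := by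
    rw [← Real.exp_nat_mul]
    norm_num
  nlinarith [Real.exp_one_lt_d9, Real.exp_pos (1 / 2)]

noncomputable section

namespace WeightedGraph

section WeightedL2

variable {V : Type*} [Fintype V] (G : WeightedGraph V)

section EdgeSum

variable {M N : Type*} [AddCommGroup M] [Module ℝ M] [AddCommGroup N] [Module ℝ N]

theorem cond_nonneg (x y : V) : 0 ≤ G.cond x y := by
  by_cases h : G.graph.Adj x y
  · exact (G.cond_pos x y h).le
  · exact (G.cond_eq_zero x y h).ge

theorem edgeSum_mono {F F' : V → V → ℝ} (hF : ∀ x y, F x y ≤ F' x y) :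
    G.edgeSum F ≤ G.edgeSum F' :=
  smul_le_smul_of_nonneg_left (Finset.sum_le_sum fun x _ => Finset.sum_le_sum fun y _ =>
    smul_le_smul_of_nonneg_left (hF x y) (G.cond_nonneg x y)) (by norm_num)

theorem map_edgeSum (φ : M →ₗ[ℝ] N) (F : V → V → M) :
    φ (G.edgeSum F) = G.edgeSum fun x y => φ (F x y) := by
  simp [edgeSum, map_sum]

theorem edgeSum_add (F F' : V → V → M) :
    G.edgeSum (fun x y => F x y + F' x y) = G.edgeSum F + G.edgeSum F' := by
  simp [edgeSum, Finset.sum_add_distrib]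

theorem edgeSum_smul (c : ℝ) (F : V → V → M) :
    G.edgeSum (fun x y => c • F x y) = c • G.edgeSum F :=
  (G.map_edgeSum (LinearMap.lsmul ℝ M c) F).symm

theorem edgeSum_const_mul (c : ℝ) (F : V → V → ℝ) :
    G.edgeSum (fun x y => c * F x y) = c * G.edgeSum F :=
  G.edgeSum_smul c F

theorem edgeSum_zero : G.edgeSum (fun _ _ => (0 : M)) = 0 := by
  simp [edgeSum]

theorem edgeSum_nonneg {F : V → V → ℝ} (hF : ∀ x y, 0 ≤ F x y) : 0 ≤ G.edgeSum F :=
  G.edgeSum_zero.symm.trans_le (G.edgeSum_mono hF)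

end EdgeSum

section InnerProduct

/-- The inner product `⟨φ, ψ⟩ = ∑ₓ π(x) φ(x) ψ(x)` of `L²(V, π)`. -/
def wtInner : LinearMap.BilinForm ℝ (V → ℝ) :=
  ∑ x, G.wt x • LinearMap.BilinForm.linMulLin (LinearMap.proj x) (LinearMap.proj x)

/-- The squared norm of `L²(V, π)`. -/
def normSq (ψ : V → ℝ) : ℝ := ∑ x, G.wt x * ψ x ^ 2

variable {G}

theorem wtInner_apply (φ ψ : V → ℝ) : G.wtInner φ ψ = ∑ x, G.wt x * (φ x * ψ x) := by
  simp [wtInner, LinearMap.BilinForm.linMulLin_apply, LinearMap.sum_apply]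

theorem wtInner_self (ψ : V → ℝ) : G.wtInner ψ ψ = G.normSq ψ := by
  simp [wtInner_apply, normSq, sq]

theorem wtInner_comm (φ ψ : V → ℝ) : G.wtInner φ ψ = G.wtInner ψ φ := by
  simp [wtInner_apply, mul_comm]

theorem wtInner_one_left (ψ : V → ℝ) : G.wtInner 1 ψ = ∑ x, G.wt x * ψ x := by
  simp [wtInner_apply]

theorem wtInner_one_one : G.wtInner 1 1 = 1 := by
  simp [wtInner_apply, G.sum_wt]

theorem normSq_nonneg (ψ : V → ℝ) : 0 ≤ G.normSq ψ :=
  Finset.sum_nonneg fun x _ => mul_nonneg (G.wt_pos x).le (sq_nonneg _)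

theorem wt_mul_sq_le_normSq (ψ : V → ℝ) (x : V) : G.wt x * ψ x ^ 2 ≤ G.normSq ψ :=
  Finset.single_le_sum (f := fun x => G.wt x * ψ x ^ 2)
    (fun x _ => mul_nonneg (G.wt_pos x).le (sq_nonneg _)) (Finset.mem_univ x)

theorem normSq_eq_zero {ψ : V → ℝ} : G.normSq ψ = 0 ↔ ψ = 0 := by
  refine ⟨fun h => funext fun x => ?_, fun h => by simp [h, normSq]⟩
  have hx := h ▸ G.wt_mul_sq_le_normSq ψ x
  exact pow_eq_zero_iff two_ne_zero |>.mp
    (le_antisymm (nonpos_of_mul_nonpos_right hx (G.wt_pos x)) (sq_nonneg _))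

theorem normSq_pos {ψ : V → ℝ} (h : ψ ≠ 0) : 0 < G.normSq ψ :=
  (normSq_nonneg ψ).lt_of_ne' (normSq_eq_zero.not.mpr h)

theorem normSq_smul (c : ℝ) (ψ : V → ℝ) : G.normSq (c • ψ) = c ^ 2 * G.normSq ψ := by
  simp only [← wtInner_self, map_smul, LinearMap.smul_apply, smul_eq_mul]
  ring

theorem normSq_add (φ ψ : V → ℝ) :
    G.normSq (φ + ψ) = G.normSq φ + 2 * G.wtInner φ ψ + G.normSq ψ := by
  simp only [← wtInner_self, map_add, LinearMap.add_apply]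
  rw [wtInner_comm ψ φ]
  ring

theorem normSq_sub_le (φ ψ : V → ℝ) : G.normSq (φ - ψ) ≤ 2 * (G.normSq φ + G.normSq ψ) := by
  have hparallelogram : G.normSq (φ - ψ) + G.normSq (φ + ψ) = 2 * (G.normSq φ + G.normSq ψ) := by
    simp only [← wtInner_self, map_add, map_sub, LinearMap.add_apply, LinearMap.sub_apply]
    ring
  linarith [G.normSq_nonneg (φ + ψ)]

theorem normSq_sub_wtInner_one_smul (ψ : V → ℝ) :
    G.normSq (ψ - G.wtInner 1 ψ • 1) = G.normSq ψ - G.wtInner 1 ψ ^ 2 := by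
  simp only [← wtInner_self, map_sub, map_smul, LinearMap.sub_apply, LinearMap.smul_apply,
    smul_eq_mul, wtInner_one_one, wtInner_comm ψ 1]
  ring

theorem wtInner_one_sub_wtInner_one_smul (ψ : V → ℝ) :
    G.wtInner 1 (ψ - G.wtInner 1 ψ • 1) = 0 := by
  rw [map_sub, map_smul, wtInner_one_one, smul_eq_mul, mul_one, sub_self]

theorem lpNorm_two (ψ : V → ℝ) : G.lpNorm 2 ψ = √(G.normSq ψ) := by
  simp [lpNorm, Real.sqrt_eq_rpow, normSq]

theorem lpNorm_nonneg (p : ℝ) (ψ : V → ℝ) : 0 ≤ G.lpNorm p ψ :=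
  Real.rpow_nonneg (Finset.sum_nonneg fun x _ =>
    mul_nonneg (G.wt_pos x).le (Real.rpow_nonneg (abs_nonneg _) p)) _

theorem lpNorm_mono {p q : ℝ} (hp : 0 < p) (hpq : p ≤ q) (ψ : V → ℝ) :
    G.lpNorm p ψ ≤ G.lpNorm q ψ := by
  have hq : 0 < q := hp.trans_le hpq
  have hjensen := Real.rpow_arith_mean_le_arith_mean_rpow Finset.univ G.wt (fun x => |ψ x| ^ p)
    (fun x _ => (G.wt_pos x).le) G.sum_wt (fun x _ => by positivity) ((one_le_div hp).mpr hpq)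
  simp only [← Real.rpow_mul (abs_nonneg _), mul_div_cancel₀ q hp.ne'] at hjensen
  have hsum : 0 ≤ ∑ x, G.wt x * |ψ x| ^ p :=
    Finset.sum_nonneg fun x _ => mul_nonneg (G.wt_pos x).le (by positivity)
  calc G.lpNorm p ψ = ((∑ x, G.wt x * |ψ x| ^ p) ^ (q / p)) ^ (1 / q) := by
        rw [lpNorm, ← Real.rpow_mul hsum]
        congr 1
        field_simp
    _ ≤ G.lpNorm q ψ := Real.rpow_le_rpow (by positivity) hjensen (by positivity)

end InnerProduct

section DirichletForm

variable {G}

theorem wt_mul_div_add_pos (x y : V) : 0 < G.wt x * G.wt y / (G.wt x + G.wt y) :=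
  div_pos (mul_pos (G.wt_pos x) (G.wt_pos y)) (add_pos (G.wt_pos x) (G.wt_pos y))

theorem dirichletForm_nonneg (ψ : V → ℝ) : 0 ≤ G.dirichletForm ψ :=
  G.edgeSum_nonneg fun x y => mul_nonneg (wt_mul_div_add_pos x y).le (sq_nonneg _)

theorem dirichletForm_smul (c : ℝ) (ψ : V → ℝ) :
    G.dirichletForm (c • ψ) = c ^ 2 * G.dirichletForm ψ := by
  rw [dirichletForm, dirichletForm, ← edgeSum_const_mul]
  congr! 3
  simp only [Pi.smul_apply, smul_eq_mul]
  ring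

theorem dirichletForm_add_smul_one (c : ℝ) (ψ : V → ℝ) :
    G.dirichletForm (ψ + c • 1) = G.dirichletForm ψ := by
  simp [dirichletForm]

theorem eq_of_dirichletForm_eq_zero {ψ : V → ℝ} (h : G.dirichletForm ψ = 0) (x y : V) :
    ψ x = ψ y := by
  have hterm : ∀ x y, 0 ≤ G.cond x y • (G.wt x * G.wt y / (G.wt x + G.wt y) *
      (ψ x - ψ y) ^ 2) := fun x y =>
    smul_nonneg (G.cond_nonneg x y) (mul_nonneg (wt_mul_div_add_pos x y).le (sq_nonneg _))
  have hadj : ∀ x y, G.graph.Adj x y → ψ x = ψ y := by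
    intro x y hxy
    unfold dirichletForm edgeSum at h
    rw [smul_eq_zero_iff_right (by norm_num), Finset.sum_eq_zero_iff_of_nonneg
      fun x _ => Finset.sum_nonneg fun y _ => hterm x y] at h
    have hx := h x (Finset.mem_univ x)
    rw [Finset.sum_eq_zero_iff_of_nonneg fun y _ => hterm x y] at hx
    simpa [(G.cond_pos x y hxy).ne', (G.wt_mul_div_add_pos x y).ne', sub_eq_zero] using
      hx y (Finset.mem_univ y)
  obtain ⟨walk⟩ := G.connected.preconnected x y
  induction walk with
  | nil => rfl
  | cons hab _ ih => exact (hadj _ _ hab).trans ih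

end DirichletForm

section Generator

variable [DecidableEq V]

/-- `P_{xy}` as a linear map. -/
def resampleLin (x y : V) : (V → ℝ) →ₗ[ℝ] (V → ℝ) where
  toFun := G.resample x y
  map_add' φ ψ := by
    funext z
    simp only [resample, Pi.add_apply]
    split_ifs <;> ring
  map_smul' c ψ := by
    funext z
    simp only [resample, Pi.smul_apply, smul_eq_mul, RingHom.id_apply]
    split_ifs <;> ring

/-- The generator `L` of the single-particle chain as a bounded operator. -/
def genCLM : (V → ℝ) →L[ℝ] (V → ℝ) :=
  LinearMap.toContinuousLinearMap (G.edgeSum fun x y => G.resampleLin x y - LinearMap.id)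

/-- The signed measure `δ_x - δ_y`, as a density with respect to `π`. -/
def dipole (x y : V) : V → ℝ :=
  Pi.single x (G.wt x)⁻¹ - Pi.single y (G.wt y)⁻¹

variable {G}

theorem genCLM_apply (ψ : V → ℝ) : G.genCLM ψ = G.edgeSum fun x y => G.resample x y ψ - ψ :=
  G.map_edgeSum (LinearMap.applyₗ ψ) fun x y => G.resampleLin x y - LinearMap.id

theorem wtInner_single (φ : V → ℝ) (x : V) (c : ℝ) :
    G.wtInner φ (Pi.single x c) = G.wt x * (φ x * c) := by
  simp [wtInner_apply, Pi.single_apply]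

theorem wtInner_dipole (φ : V → ℝ) (x y : V) : G.wtInner φ (G.dipole x y) = φ x - φ y := by
  have hx := (G.wt_pos x).ne'
  have hy := (G.wt_pos y).ne'
  rw [dipole, map_sub, wtInner_single, wtInner_single]
  field_simp

theorem wtInner_one_dipole (x y : V) : G.wtInner 1 (G.dipole x y) = 0 := by
  simp [wtInner_dipole]

theorem dipole_self (x : V) : G.dipole x x = 0 :=
  sub_self _

theorem normSq_dipole {x y : V} (hxy : x ≠ y) :
    G.normSq (G.dipole x y) = (G.wt x)⁻¹ + (G.wt y)⁻¹ := by
  rw [← wtInner_self, wtInner_dipole]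
  simp [dipole, hxy, hxy.symm]

theorem resample_sub_self (x y : V) (ψ : V → ℝ) :
    G.resample x y ψ - ψ =
      (G.wt x * G.wt y / (G.wt x + G.wt y) * (ψ y - ψ x)) • G.dipole x y := by
  have hx := G.wt_pos x
  have hy := G.wt_pos y
  funext z
  simp only [resample, dipole, Pi.sub_apply, Pi.smul_apply, smul_eq_mul, Pi.single_apply]
  by_cases hzx : z = x <;> by_cases hzy : z = y
  · subst hzx hzy
    simp only [or_self, if_true, sub_self, mul_zero]
    field_simp
    ring
  · subst hzx
    simp only [hzy, or_false, if_true, if_false, sub_zero]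
    field_simp
    ring
  · subst hzy
    simp only [hzx, false_or, if_true, if_false, zero_sub]
    field_simp
    ring
  · simp [hzx, hzy]

theorem wtInner_resample_sub (x y : V) (φ ψ : V → ℝ) :
    G.wtInner φ (G.resample x y ψ - ψ) =
      -(G.wt x * G.wt y / (G.wt x + G.wt y) * ((φ x - φ y) * (ψ x - ψ y))) := by
  rw [resample_sub_self, map_smul, wtInner_dipole, smul_eq_mul]
  ring

theorem normSq_resample_sub (x y : V) (ψ : V → ℝ) :
    G.normSq (G.resample x y ψ - ψ) =
      G.wt x * G.wt y / (G.wt x + G.wt y) * (ψ x - ψ y) ^ 2 := by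
  have hx := G.wt_pos x
  have hy := G.wt_pos y
  rw [resample_sub_self, normSq_smul]
  rcases eq_or_ne x y with rfl | hxy
  · simp
  · rw [normSq_dipole hxy]
    field_simp
    ring

theorem dirichletForm_eq_edgeSum_normSq (ψ : V → ℝ) :
    G.dirichletForm ψ = G.edgeSum fun x y => G.normSq (G.resample x y ψ - ψ) := by
  simp only [dirichletForm, normSq_resample_sub]

theorem wtInner_genCLM (φ ψ : V → ℝ) :
    G.wtInner φ (G.genCLM ψ) = -G.edgeSum fun x y =>
      G.wt x * G.wt y / (G.wt x + G.wt y) * ((φ x - φ y) * (ψ x - ψ y)) := by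
  rw [genCLM_apply, map_edgeSum, ← neg_one_mul, ← edgeSum_const_mul]
  simp only [wtInner_resample_sub, neg_one_mul]

theorem wtInner_genCLM_left (φ ψ : V → ℝ) :
    G.wtInner (G.genCLM φ) ψ = G.wtInner φ (G.genCLM ψ) := by
  simp only [wtInner_comm _ ψ, wtInner_genCLM, mul_comm (ψ _ - ψ _)]

theorem wtInner_genCLM_self (ψ : V → ℝ) : G.wtInner ψ (G.genCLM ψ) = -G.dirichletForm ψ := by
  simp only [wtInner_genCLM, dirichletForm, sq]

theorem genCLM_one : G.genCLM 1 = 0 := by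
  rw [genCLM_apply]
  simp [resample_sub_self, edgeSum_zero]

end Generator

section SpectralGap

/-- The mean-zero functions of unit norm in `L²(V, π)`, on which the Dirichlet form is the Rayleigh
quotient. -/
def unitMeanZero : Set (V → ℝ) := {ψ | G.normSq ψ = 1 ∧ G.wtInner 1 ψ = 0}

variable {G}

theorem isCompact_unitMeanZero : IsCompact G.unitMeanZero := by
  have hbox : IsCompact (Set.univ.pi fun x => Set.Icc (-√(G.wt x)⁻¹) √(G.wt x)⁻¹) :=
    isCompact_univ_pi fun x => isCompact_Icc
  refine hbox.of_isClosed_subset (IsClosed.inter ?_ ?_) fun ψ hψ x _ => ?_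
  · exact isClosed_eq (by unfold normSq; fun_prop) continuous_const
  · exact isClosed_eq (LinearMap.continuous_of_finiteDimensional _) continuous_const
  · refine abs_le.mp (Real.abs_le_sqrt ?_)
    rw [← one_div, le_div_iff₀' (G.wt_pos x)]
    exact hψ.1 ▸ wt_mul_sq_le_normSq ψ x

theorem continuous_dirichletForm : Continuous G.dirichletForm := by
  unfold dirichletForm edgeSum
  fun_prop

theorem smul_mem_unitMeanZero {ψ : V → ℝ} (hψ : ψ ≠ 0) (hmean : G.wtInner 1 ψ = 0) :
    (√(G.normSq ψ))⁻¹ • ψ ∈ G.unitMeanZero := by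
  refine ⟨?_, by rw [map_smul, hmean, smul_zero]⟩
  rw [normSq_smul, inv_pow, Real.sq_sqrt (normSq_nonneg ψ), inv_mul_cancel₀ (normSq_pos hψ).ne']

theorem dirichletForm_inv_sqrt_normSq_smul (ψ : V → ℝ) :
    G.dirichletForm ((√(G.normSq ψ))⁻¹ • ψ) = G.dirichletForm ψ / G.normSq ψ := by
  rw [dirichletForm_smul, inv_pow, Real.sq_sqrt (normSq_nonneg ψ), div_eq_inv_mul]

theorem unitMeanZero_nonempty [Nontrivial V] : G.unitMeanZero.Nonempty := by
  classical
  obtain ⟨x, y, hxy⟩ := exists_pair_ne V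
  refine ⟨_, smul_mem_unitMeanZero (ψ := G.dipole x y) ?_ (wtInner_one_dipole x y)⟩
  rw [Ne, ← normSq_eq_zero, normSq_dipole hxy]
  exact (add_pos (inv_pos.mpr (G.wt_pos x)) (inv_pos.mpr (G.wt_pos y))).ne'

variable [DecidableEq V]

theorem gap_eq_sInf_dirichletForm : G.gap = sInf (G.dirichletForm '' G.unitMeanZero) := by
  have hrayleigh : ∀ ψ : V → ℝ, (∑ x, G.wt x * (ψ x * (-G.binGenerator ψ x))) /
      ∑ x, G.wt x * ψ x ^ 2 = G.dirichletForm ψ / G.normSq ψ := fun ψ => by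
    rw [← neg_neg (G.dirichletForm ψ), ← wtInner_genCLM_self, genCLM_apply, wtInner_apply, normSq,
      ← Finset.sum_neg_distrib]
    simp only [mul_neg, binGenerator]
  unfold gap
  congr 1
  ext r
  simp only [hrayleigh, Set.mem_ofPred_eq, Set.mem_image]
  constructor
  · rintro ⟨ψ, hψ, hmean, rfl⟩
    exact ⟨_, smul_mem_unitMeanZero hψ (wtInner_one_left ψ ▸ hmean),
      dirichletForm_inv_sqrt_normSq_smul ψ⟩
  · rintro ⟨ψ, ⟨hnorm, hmean⟩, rfl⟩
    refine ⟨ψ, ?_, wtInner_one_left ψ ▸ hmean, by rw [hnorm, div_one]⟩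
    rintro rfl
    simp [normSq] at hnorm

theorem gap_nonneg : 0 ≤ G.gap := by
  rw [gap_eq_sInf_dirichletForm]
  exact Real.sInf_nonneg (Set.forall_mem_image.mpr fun ψ _ => dirichletForm_nonneg ψ)

theorem gap_mul_normSq_le {ψ : V → ℝ} (hmean : G.wtInner 1 ψ = 0) :
    G.gap * G.normSq ψ ≤ G.dirichletForm ψ := by
  rcases eq_or_ne ψ 0 with rfl | hψ
  · simp [normSq, dirichletForm_nonneg]
  · rw [← le_div_iff₀ (normSq_pos hψ), ← dirichletForm_inv_sqrt_normSq_smul,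
      gap_eq_sInf_dirichletForm]
    exact csInf_le ⟨0, Set.forall_mem_image.mpr fun ψ _ => dirichletForm_nonneg ψ⟩
      (Set.mem_image_of_mem _ (smul_mem_unitMeanZero hψ hmean))

theorem exists_dirichletForm_eq_gap [Nontrivial V] :
    ∃ ψ ∈ G.unitMeanZero, G.dirichletForm ψ = G.gap := by
  rw [gap_eq_sInf_dirichletForm]
  exact (isCompact_unitMeanZero.image continuous_dirichletForm).sInf_mem
    (unitMeanZero_nonempty.image _)

theorem gap_pos [Nontrivial V] : 0 < G.gap := by
  obtain ⟨ψ, ⟨hnorm, hmean⟩, hψ⟩ := G.exists_dirichletForm_eq_gap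
  refine gap_nonneg.lt_of_ne' fun h => ?_
  have hconst := eq_of_dirichletForm_eq_zero (hψ.trans h)
  have hzero : ψ = 0 := funext fun x => by
    rw [wtInner_one_left] at hmean
    simp_rw [hconst _ x, ← Finset.sum_mul, G.sum_wt, one_mul] at hmean
    exact hmean
  simp [hzero, normSq] at hnorm

theorem tRel_pos [Nontrivial V] : 0 < G.tRel :=
  inv_pos.mpr gap_pos

/-- The positive semidefinite form `⟨φ, (-L - gap) ψ⟩ + gap ⟨φ, 1⟩ ⟨1, ψ⟩`, whose kernel contains
the minimisers of the Rayleigh quotient. -/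
def gapDefectForm (G : WeightedGraph V) : LinearMap.BilinForm ℝ (V → ℝ) :=
  -G.wtInner.compRight G.genCLM - G.gap • G.wtInner +
    G.gap • LinearMap.BilinForm.linMulLin (G.wtInner 1) (G.wtInner 1)

theorem gapDefectForm_apply (φ ψ : V → ℝ) : G.gapDefectForm φ ψ =
    -G.wtInner φ (G.genCLM ψ) - G.gap * G.wtInner φ ψ +
      G.gap * (G.wtInner 1 φ * G.wtInner 1 ψ) := rfl

theorem gapDefectForm_comm (φ ψ : V → ℝ) : G.gapDefectForm φ ψ = G.gapDefectForm ψ φ := by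
  rw [gapDefectForm_apply, gapDefectForm_apply, ← wtInner_genCLM_left, wtInner_comm _ ψ,
    wtInner_comm φ ψ, mul_comm (G.wtInner 1 φ)]

theorem gapDefectForm_self_nonneg (ψ : V → ℝ) : 0 ≤ G.gapDefectForm ψ ψ := by
  have h := gap_mul_normSq_le (G.wtInner_one_sub_wtInner_one_smul ψ)
  rw [normSq_sub_wtInner_one_smul, sub_eq_add_neg ψ, ← neg_smul, dirichletForm_add_smul_one] at h
  rw [gapDefectForm_apply, wtInner_genCLM_self, wtInner_self]
  linarith

theorem exists_eigenfunction [Nontrivial V] :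
    ∃ ψ ∈ G.unitMeanZero, G.genCLM ψ = -G.gap • ψ := by
  obtain ⟨ψ, ⟨hnorm, hmean⟩, hψ⟩ := G.exists_dirichletForm_eq_gap
  refine ⟨ψ, ⟨hnorm, hmean⟩, ?_⟩
  have hself : G.gapDefectForm ψ ψ = 0 := by
    rw [gapDefectForm_apply, wtInner_genCLM_self, wtInner_self, hnorm, hmean, hψ]
    ring
  have hker : ∀ φ, G.gapDefectForm φ ψ = 0 := fun φ => by
    have h := LinearMap.BilinForm.apply_mul_apply_le_of_forall_zero_le G.gapDefectForm
      gapDefectForm_self_nonneg φ ψ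
    rw [hself, mul_zero, gapDefectForm_comm ψ φ] at h
    exact mul_self_eq_zero.mp (le_antisymm h (mul_self_nonneg _))
  have hresidual : G.normSq (G.genCLM ψ - -G.gap • ψ) = 0 := by
    have h := hker (G.genCLM ψ - -G.gap • ψ)
    rw [gapDefectForm_apply, hmean] at h
    rw [← wtInner_self, map_sub, map_smul, smul_eq_mul]
    linarith
  exact sub_eq_zero.mp (normSq_eq_zero.mp hresidual)

end SpectralGap

end WeightedL2

section Noise

variable {V : Type*} [Fintype V] (G : WeightedGraph V)

section Fluctuation

/-- The fluctuation `η / π - 1` of a configuration around equilibrium. -/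
def fluct (η : stdSimplex ℝ V) : V → ℝ := fun x => η.1 x / G.wt x - 1

theorem continuous_fluct : Continuous G.fluct :=
  continuous_pi fun x =>
    (((continuous_apply x).comp continuous_subtype_val).div_const _).sub continuous_const

/-- The linear observable `η ↦ ⟨ψ, η / π - 1⟩`. -/
def pairing (ψ : V → ℝ) : C(stdSimplex ℝ V, ℝ) where
  toFun η := G.wtInner ψ (G.fluct η)
  continuous_toFun := (LinearMap.continuous_of_finiteDimensional (G.wtInner ψ)).comp
    G.continuous_fluct

/-- The quadratic observable `η ↦ ⟨h, A h⟩` with `h = η / π - 1`, which depends linearly on the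
operator `A`. -/
def quadObs : ((V → ℝ) →L[ℝ] (V → ℝ)) →L[ℝ] C(stdSimplex ℝ V, ℝ) :=
  LinearMap.toContinuousLinearMap
    { toFun := fun A =>
        { toFun := fun η => G.wtInner (G.fluct η) (A (G.fluct η))
          continuous_toFun := by
            have h := G.continuous_fluct
            exact (G.wtInner.toContinuousBilinearMap.continuous.comp h).clm_apply
              (A.continuous.comp h) }
      map_add' := fun A B => ContinuousMap.ext fun η => map_add (G.wtInner (G.fluct η)) _ _
      map_smul' := fun c A => ContinuousMap.ext fun η => map_smul (G.wtInner (G.fluct η)) c _ }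

/-- The squared distance to equilibrium `η ↦ ‖η / π - 1‖₂²`. -/
def fluctSq : C(stdSimplex ℝ V, ℝ) :=
  G.quadObs 1

variable {G}

theorem wtInner_one_fluct (η : stdSimplex ℝ V) : G.wtInner 1 (G.fluct η) = 0 := by
  have hcancel : ∀ x, G.wt x * (η.1 x / G.wt x) = η.1 x := fun x =>
    mul_div_cancel₀ _ (G.wt_pos x).ne'
  simp only [wtInner_one_left, fluct, mul_sub, hcancel, mul_one, Finset.sum_sub_distrib, η.2.2,
    G.sum_wt, sub_self]

theorem quadObs_apply (A : (V → ℝ) →L[ℝ] (V → ℝ)) (η : stdSimplex ℝ V) :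
    G.quadObs A η = G.wtInner (G.fluct η) (A (G.fluct η)) := rfl

theorem fluctSq_apply (η : stdSimplex ℝ V) : G.fluctSq η = G.normSq (G.fluct η) :=
  wtInner_self _

theorem fluctSq_nonneg : 0 ≤ G.fluctSq :=
  fun η => (normSq_nonneg (G.fluct η)).trans_eq (fluctSq_apply η).symm

end Fluctuation

variable [DecidableEq V]

section Heat

/-- The semigroup `exp(t L)` of the single-particle chain. -/
def heat (t : ℝ) : (V → ℝ) →L[ℝ] (V → ℝ) :=
  expSemigroup G.genCLM t

variable {G}

theorem heat_zero : G.heat 0 = 1 :=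
  expSemigroup_zero _

theorem heat_add_apply (s t : ℝ) (ψ : V → ℝ) : G.heat (s + t) ψ = G.heat s (G.heat t ψ) := by
  rw [heat, expSemigroup_add]
  rfl

theorem wtInner_heat_left (t : ℝ) (φ ψ : V → ℝ) :
    G.wtInner (G.heat t φ) ψ = G.wtInner φ (G.heat t ψ) :=
  expSemigroup_apply_eq_of_symmetric (B := G.wtInner.toContinuousBilinearMap)
    (fun φ ψ => wtInner_genCLM_left φ ψ) t φ ψ

theorem normSq_heat (t : ℝ) (ψ : V → ℝ) :
    G.normSq (G.heat t ψ) = G.wtInner ψ (G.heat (2 * t) ψ) := by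
  rw [← wtInner_self, wtInner_heat_left, ← heat_add_apply, two_mul]

theorem wtInner_one_heat (t : ℝ) (ψ : V → ℝ) : G.wtInner 1 (G.heat t ψ) = G.wtInner 1 ψ := by
  have hone : G.heat t 1 = 1 := by
    simpa [heat] using expSemigroup_apply_of_eigenvector (μ := 0) (by simp [genCLM_one]) t
  rw [← wtInner_heat_left, hone]

theorem hasDerivAt_normSq_heat (ψ : V → ℝ) (t : ℝ) :
    HasDerivAt (fun s => G.normSq (G.heat s ψ)) (-2 * G.dirichletForm (G.heat t ψ)) t := by
  have hflow : HasDerivAt (fun s => G.heat s ψ) (G.genCLM (G.heat t ψ)) t :=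
    (hasDerivAt_expSemigroup G.genCLM t).clm_apply (hasDerivAt_const t ψ) |>.congr_deriv
      (by simp [heat])
  have h := G.wtInner.toContinuousBilinearMap.hasDerivAt_of_bilinear (fun _ => hflow)
    (fun _ => hflow)
  simp only [LinearMap.toContinuousBilinearMap_apply, wtInner_genCLM_left, wtInner_genCLM_self,
    wtInner_self] at h
  exact h.congr_deriv (by ring)

theorem normSq_heat_le {ψ : V → ℝ} (hmean : G.wtInner 1 ψ = 0) {t : ℝ} (ht : 0 ≤ t) :
    G.normSq (G.heat t ψ) ≤ Real.exp (-(2 * G.gap * t)) * G.normSq ψ := by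
  have h := le_exp_mul_of_hasDerivAt_le (l := 2 * G.gap) ht
    (fun s _ => G.hasDerivAt_normSq_heat ψ s) fun s _ => by
      linarith [gap_mul_normSq_le ((G.wtInner_one_heat s ψ).trans hmean)]
  simpa [heat_zero] using h

theorem normSq_heat_le_self {ψ : V → ℝ} (hmean : G.wtInner 1 ψ = 0) {t : ℝ} (ht : 0 ≤ t) :
    G.normSq (G.heat t ψ) ≤ G.normSq ψ := by
  refine (normSq_heat_le hmean ht).trans (mul_le_of_le_one_left (normSq_nonneg ψ) ?_)
  rw [Real.exp_le_one_iff, neg_nonpos]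
  exact mul_nonneg (mul_nonneg two_pos.le gap_nonneg) ht

end Heat

section Observables

/-- The observable `η ↦ ‖exp(r L) (η / π - 1)‖₂²`. -/
def heatSq (r : ℝ) : C(stdSimplex ℝ V, ℝ) :=
  G.quadObs (G.heat (2 * r))

/-- The observable `η ↦ ∑_{xy ∈ E} c_{xy} ‖exp(r L) (P_{xy} h - h)‖₂²` with `h = η / π - 1`: the
rate at which the randomness of the Averaging process feeds `‖exp(r L) (η / π - 1)‖₂²`. -/
def noise (r : ℝ) : C(stdSimplex ℝ V, ℝ) where
  toFun η := G.edgeSum fun x y => G.normSq (G.heat r (G.resample x y (G.fluct η) - G.fluct η))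
  continuous_toFun := by
    have h := G.continuous_fluct
    have hresample : ∀ x y, Continuous (G.resample x y) := fun x y =>
      LinearMap.continuous_of_finiteDimensional (G.resampleLin x y)
    unfold edgeSum normSq
    fun_prop

variable {G}

theorem fluct_split (x y : V) (η : stdSimplex ℝ V) :
    G.fluct (G.split x y η) = G.resample x y (G.fluct η) := by
  have hx := G.wt_pos x
  have hy := G.wt_pos y
  funext z
  simp only [fluct, split, splitFun, resample, ContinuousMap.coe_mk]
  by_cases hzx : z = x
  · subst hzx
    simp only [true_or, if_true]
    field_simp
    ring
  by_cases hzy : z = y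
  · subst hzy
    simp only [hzx, false_or, if_true, if_false]
    field_simp
    ring
  · simp only [hzx, hzy, or_self, if_false]

theorem heatSq_apply (r : ℝ) (η : stdSimplex ℝ V) :
    G.heatSq r η = G.normSq (G.heat r (G.fluct η)) :=
  (normSq_heat r (G.fluct η)).symm

theorem heatSq_zero : G.heatSq 0 = G.fluctSq := by
  rw [heatSq, mul_zero, heat_zero, fluctSq]

theorem noise_nonneg (r : ℝ) : 0 ≤ G.noise r :=
  fun _ => G.edgeSum_nonneg fun _ _ => normSq_nonneg _

theorem noise_zero_apply (η : stdSimplex ℝ V) : G.noise 0 η = G.dirichletForm (G.fluct η) := by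
  rw [dirichletForm_eq_edgeSum_normSq]
  simp [noise, heat_zero]

theorem avgGenerator_apply (f : C(stdSimplex ℝ V, ℝ)) (η : stdSimplex ℝ V) :
    G.avgGenerator f η = G.edgeSum fun x y => f (G.split x y η) - f η :=
  G.map_edgeSum ((ContinuousMap.evalCLM ℝ η).toLinearMap.comp
    (ContinuousLinearMap.apply ℝ _ f).toLinearMap)
    fun x y => ContinuousMap.compCLM ℝ ℝ (G.split x y) - ContinuousLinearMap.id ℝ _

theorem avgGenerator_pairing (ψ : V → ℝ) :
    G.avgGenerator (G.pairing ψ) = G.pairing (G.genCLM ψ) := by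
  ext η
  have hjump : ∀ x y, G.pairing ψ (G.split x y η) - G.pairing ψ η =
      G.wtInner ψ (G.resample x y (G.fluct η) - G.fluct η) := fun x y => by
    rw [map_sub, ← fluct_split]
    rfl
  simp only [avgGenerator_apply, hjump]
  rw [← map_edgeSum, ← genCLM_apply, ← wtInner_genCLM_left]
  rfl

theorem avgGenerator_quadObs_apply {A : (V → ℝ) →L[ℝ] (V → ℝ)}
    (hA : ∀ φ ψ, G.wtInner (A φ) ψ = G.wtInner φ (A ψ)) (η : stdSimplex ℝ V) :
    G.avgGenerator (G.quadObs A) η = 2 * G.quadObs (A * G.genCLM) η + G.edgeSum fun x y =>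
      G.wtInner (G.resample x y (G.fluct η) - G.fluct η)
        (A (G.resample x y (G.fluct η) - G.fluct η)) := by
  set h := G.fluct η with hh
  have hjump : ∀ x y, G.quadObs A (G.split x y η) - G.quadObs A η =
      2 * G.wtInner (A h) (G.resample x y h - h) +
        G.wtInner (G.resample x y h - h) (A (G.resample x y h - h)) := fun x y => by
    simp only [quadObs_apply, fluct_split, ← hh, map_sub, LinearMap.sub_apply, hA]
    rw [← hA (G.resample x y h) h, wtInner_comm (A _) h]
    ring
  simp only [avgGenerator_apply, hjump]
  rw [edgeSum_add, edgeSum_const_mul, ← map_edgeSum, ← genCLM_apply, hA]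
  rfl

theorem avgGenerator_heatSq (r : ℝ) :
    G.avgGenerator (G.heatSq r) = 2 • G.quadObs (G.genCLM * G.heat (2 * r)) + G.noise r := by
  ext η
  have hcomm : G.heat (2 * r) * G.genCLM = G.genCLM * G.heat (2 * r) :=
    ContinuousLinearMap.ext fun ψ => expSemigroup_apply_comm G.genCLM (2 * r) ψ
  rw [heatSq, avgGenerator_quadObs_apply (G.wtInner_heat_left (2 * r)), hcomm, two_smul, two_mul]
  simp only [← normSq_heat]
  rfl

theorem avgGenerator_fluctSq : G.avgGenerator G.fluctSq = -G.noise 0 := by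
  rw [← heatSq_zero, avgGenerator_heatSq]
  ext η
  have henergy : G.quadObs (G.genCLM * G.heat (2 * 0)) η = -G.noise 0 η := by
    rw [mul_zero, heat_zero, mul_one, quadObs_apply, wtInner_genCLM_self, noise_zero_apply]
  simp only [ContinuousMap.add_apply, ContinuousMap.smul_apply, ContinuousMap.neg_apply, henergy]
  ring

theorem hasDerivAt_heatSq (r : ℝ) :
    HasDerivAt G.heatSq (2 • G.quadObs (G.genCLM * G.heat (2 * r))) r := by
  have hheat : HasDerivAt (fun r => G.heat (2 * r)) (2 • (G.genCLM * G.heat (2 * r))) r := by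
    refine ((hasDerivAt_expSemigroup G.genCLM (2 * r)).scomp r
      ((hasDerivAt_id r).const_mul 2)).congr_deriv ?_
    rw [mul_one, ofNat_smul_eq_nsmul]
    rfl
  exact (G.quadObs.hasFDerivAt.comp_hasDerivAt r hheat).congr_deriv (map_nsmul _ _ _)

end Observables

end Noise

section Evolution

variable {V : Type*} [Fintype V] [DecidableEq V] (G : WeightedGraph V)

section Law

/-- The law of `η_t` for the Averaging process started from `η`, as the functional
`f ↦ E_η[f(η_t)]` on `C(Δ)`. -/
def avgLaw (η : stdSimplex ℝ V) (t : ℝ) : C(stdSimplex ℝ V, ℝ) →L[ℝ] ℝ :=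
  (ContinuousMap.evalCLM ℝ η).comp (G.avgSemigroup t)

variable {G}

theorem avgLaw_zero (η : stdSimplex ℝ V) (f : C(stdSimplex ℝ V, ℝ)) : G.avgLaw η 0 f = f η := by
  simp [avgLaw, avgSemigroup, expSemigroup_zero]

theorem avgLaw_add (η : stdSimplex ℝ V) (s t : ℝ) (f : C(stdSimplex ℝ V, ℝ)) :
    G.avgLaw η (s + t) f = G.avgLaw η s (G.avgSemigroup t f) := by
  simp [avgLaw, avgSemigroup, expSemigroup_add]

theorem avgLaw_nonneg (η : stdSimplex ℝ V) {t : ℝ} (ht : 0 ≤ t) {f : C(stdSimplex ℝ V, ℝ)}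
    (hf : 0 ≤ f) : 0 ≤ G.avgLaw η t f := by
  have hshift : ∀ f : C(stdSimplex ℝ V, ℝ), 0 ≤ f →
      0 ≤ G.avgGenerator f + G.edgeSum (fun _ _ => (1 : ℝ)) • f := fun f hf =>
    ContinuousMap.le_def.mpr fun ξ => by
      have hjump : ∀ x y, 0 ≤ f (G.split x y ξ) - f ξ + f ξ * 1 := fun x y => by
        have hsplit : 0 ≤ f (G.split x y ξ) := ContinuousMap.le_def.mp hf _
        linarith
      rw [ContinuousMap.add_apply, ContinuousMap.smul_apply, avgGenerator_apply, smul_eq_mul,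
        mul_comm, ← edgeSum_const_mul, ← edgeSum_add]
      exact G.edgeSum_nonneg hjump
  exact ContinuousMap.le_def.mp (expSemigroup_nonneg hshift ht hf) η

theorem monotone_avgLaw (η : stdSimplex ℝ V) {t : ℝ} (ht : 0 ≤ t) : Monotone (G.avgLaw η t) :=
  (monotone_iff_map_nonneg _).mpr fun _ hf => avgLaw_nonneg η ht hf

theorem avgLaw_one (η : stdSimplex ℝ V) (t : ℝ) : G.avgLaw η t 1 = 1 := by
  have hgen : G.avgGenerator 1 = (0 : ℝ) • 1 := ContinuousMap.ext fun η => by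
    simp [avgGenerator_apply, edgeSum_zero]
  simp [avgLaw, avgSemigroup, expSemigroup_apply_of_eigenvector hgen]

theorem hasDerivAt_avgLaw (η : stdSimplex ℝ V) {g : ℝ → C(stdSimplex ℝ V, ℝ)}
    {g' : C(stdSimplex ℝ V, ℝ)} {t : ℝ} (hg : HasDerivAt g g' t) :
    HasDerivAt (fun s => G.avgLaw η s (g s)) (G.avgLaw η t (G.avgGenerator (g t) + g')) t :=
  (ContinuousMap.evalCLM ℝ η : C(stdSimplex ℝ V, ℝ) →L[ℝ] ℝ).hasFDerivAt.comp_hasDerivAt t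
    (hasDerivAt_expSemigroup_apply hg)

theorem hasDerivAt_avgLaw_fluctSq (η : stdSimplex ℝ V) (t : ℝ) :
    HasDerivAt (fun s => G.avgLaw η s G.fluctSq) (-G.avgLaw η t (G.noise 0)) t :=
  (hasDerivAt_avgLaw η (hasDerivAt_const t G.fluctSq)).congr_deriv <| by
    rw [avgGenerator_fluctSq, add_zero, map_neg]

theorem hasDerivAt_avgLaw_heatSq (η : stdSimplex ℝ V) (t s : ℝ) :
    HasDerivAt (fun s => G.avgLaw η s (G.heatSq (t - s))) (G.avgLaw η s (G.noise (t - s))) s :=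
  (hasDerivAt_avgLaw η ((hasDerivAt_heatSq (t - s)).comp_const_sub t s)).congr_deriv <| by
    rw [avgGenerator_heatSq, add_neg_cancel_comm]

end Law

section Contraction

variable {G}

theorem gap_smul_fluctSq_le : G.gap • G.fluctSq ≤ G.noise 0 := ContinuousMap.le_def.mpr fun η => by
  rw [ContinuousMap.smul_apply, fluctSq_apply, noise_zero_apply]
  exact gap_mul_normSq_le (wtInner_one_fluct η)

theorem avgLaw_fluctSq_le (η : stdSimplex ℝ V) {t : ℝ} (ht : 0 ≤ t) :
    G.avgLaw η t G.fluctSq ≤ Real.exp (-(G.gap * t)) * G.fluctSq η := by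
  have h := le_exp_mul_of_hasDerivAt_le (l := G.gap) ht
    (fun s _ => G.hasDerivAt_avgLaw_fluctSq η s) fun s hs => by
      have hgap := G.monotone_avgLaw η hs.1 G.gap_smul_fluctSq_le
      rw [map_smul, smul_eq_mul] at hgap
      linarith
  rwa [avgLaw_zero] at h

theorem normSq_heat_fluct_le_avgLaw (η : stdSimplex ℝ V) {t : ℝ} (ht : 0 ≤ t) :
    G.normSq (G.heat t (G.fluct η)) ≤ G.avgLaw η t G.fluctSq := by
  have hanti := antitoneOn_Icc_of_hasDerivAt_nonpos
    (fun s (_ : s ∈ Set.Icc 0 t) => (G.hasDerivAt_avgLaw_heatSq η t s).neg)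
    fun s hs => neg_nonpos.mpr (avgLaw_nonneg η hs.1 (noise_nonneg _))
  have h := neg_le_neg_iff.mp (hanti (Set.left_mem_Icc.mpr ht) (Set.right_mem_Icc.mpr ht) ht)
  simpa [avgLaw_zero, heatSq_apply, heatSq_zero] using h

theorem dipole_eq_fluct_sub_fluct (x y : V) :
    G.dipole x y = G.fluct ⟨Pi.single x 1, single_mem_stdSimplex ℝ x⟩ -
      G.fluct ⟨Pi.single y 1, single_mem_stdSimplex ℝ y⟩ := by
  funext z
  simp only [dipole, fluct, Pi.sub_apply, Pi.single_apply]
  rcases eq_or_ne z x with rfl | hx <;> rcases eq_or_ne z y with rfl | hy <;>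
    simp [*, neg_eq_iff_eq_neg]

theorem normSq_heat_dipole_le {b K : ℝ} (hK : ∀ η, G.normSq (G.heat b (G.fluct η)) ≤ K)
    {r : ℝ} (hr : b ≤ r) (x y : V) :
    G.normSq (G.heat r (G.dipole x y)) ≤ Real.exp (-(2 * G.gap * (r - b))) * (4 * K) := by
  have hb : G.normSq (G.heat b (G.dipole x y)) ≤ 4 * K := by
    rw [dipole_eq_fluct_sub_fluct, map_sub]
    refine (normSq_sub_le _ _).trans ?_
    linarith [hK ⟨Pi.single x 1, single_mem_stdSimplex ℝ x⟩,
      hK ⟨Pi.single y 1, single_mem_stdSimplex ℝ y⟩]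
  have hmean : G.wtInner 1 (G.heat b (G.dipole x y)) = 0 := by
    rw [wtInner_one_heat, wtInner_one_dipole]
  rw [← sub_add_cancel r b, heat_add_apply, sub_add_cancel]
  exact (normSq_heat_le hmean (sub_nonneg.mpr hr)).trans
    (mul_le_mul_of_nonneg_left hb (Real.exp_pos _).le)

theorem two_le_mul_normSq_dipole {m : ℝ} (hm : ∀ x, G.wt x ≤ m) {x y : V} (hxy : x ≠ y) :
    2 ≤ m * G.normSq (G.dipole x y) := by
  have hone : ∀ x, 1 ≤ m * (G.wt x)⁻¹ := fun x => by
    rw [← div_eq_mul_inv, one_le_div (G.wt_pos x)]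
    exact hm x
  rw [normSq_dipole hxy]
  linarith [hone x, hone y]

theorem noise_le_smul_noise_zero {q r : ℝ}
    (hq : ∀ x y, G.normSq (G.heat r (G.dipole x y)) ≤ q * G.normSq (G.dipole x y)) :
    G.noise r ≤ q • G.noise 0 := ContinuousMap.le_def.mpr fun η => by
  rw [ContinuousMap.smul_apply, smul_eq_mul]
  refine (G.edgeSum_mono fun x y => ?_).trans_eq (G.edgeSum_const_mul q _)
  rw [resample_sub_self, heat_zero, map_smul, normSq_smul, one_apply_eq_self, normSq_smul,
    mul_left_comm]
  exact mul_le_mul_of_nonneg_left (hq x y) (sq_nonneg _)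

theorem noise_le_noise_zero {r : ℝ} (hr : 0 ≤ r) : G.noise r ≤ G.noise 0 := by
  rw [← one_smul ℝ (G.noise 0)]
  refine noise_le_smul_noise_zero fun x y => ?_
  rw [one_mul]
  exact normSq_heat_le_self (wtInner_one_dipole x y) hr

theorem noise_le_exp_smul_noise_zero {b K m : ℝ} (hgb : G.gap * b ≤ 1 / 4)
    (hK : ∀ η, G.normSq (G.heat b (G.fluct η)) ≤ K) (hm : ∀ x, G.wt x ≤ m) {r : ℝ}
    (hr : b ≤ r) : G.noise r ≤ (4 * K * m * Real.exp (-(2 * G.gap * r))) • G.noise 0 := by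
  refine noise_le_smul_noise_zero fun x y => ?_
  rcases eq_or_ne x y with rfl | hxy
  · simp [dipole_self, normSq]
  have hK0 : 0 ≤ K := (normSq_nonneg _).trans (hK ⟨Pi.single x 1, single_mem_stdSimplex ℝ x⟩)
  have hshift : Real.exp (-(2 * G.gap * (r - b))) ≤ 2 * Real.exp (-(2 * G.gap * r)) := by
    rw [show -(2 * G.gap * (r - b)) = 2 * (G.gap * b) + -(2 * G.gap * r) by ring, Real.exp_add]
    refine mul_le_mul_of_nonneg_right ?_ (Real.exp_pos _).le
    exact (Real.exp_le_exp.mpr (by linarith)).trans (exp_half_le.trans (by norm_num))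
  calc G.normSq (G.heat r (G.dipole x y))
      ≤ Real.exp (-(2 * G.gap * (r - b))) * (4 * K) := normSq_heat_dipole_le hK hr x y
    _ ≤ 2 * Real.exp (-(2 * G.gap * r)) * (4 * K) := by gcongr
    _ = 4 * K * Real.exp (-(2 * G.gap * r)) * 2 := by ring
    _ ≤ 4 * K * Real.exp (-(2 * G.gap * r)) * (m * G.normSq (G.dipole x y)) := by
        gcongr
        exact two_le_mul_normSq_dipole hm hxy
    _ = 4 * K * m * Real.exp (-(2 * G.gap * r)) * G.normSq (G.dipole x y) := by ring

end Contraction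

section Recursion

variable {G}

theorem two_mul_avgLaw_fluctSq_le (η : stdSimplex ℝ V) {s t : ℝ} (hs : 0 ≤ s) (hst : s ≤ t) :
    2 * G.avgLaw η t G.fluctSq ≤ G.avgLaw η s G.fluctSq + G.avgLaw η s (G.heatSq (t - s)) := by
  have hanti := antitoneOn_Icc_of_hasDerivAt_nonpos
    (fun u (_ : u ∈ Set.Icc s t) =>
      (G.hasDerivAt_avgLaw_heatSq η t u).add (G.hasDerivAt_avgLaw_fluctSq η u))
    fun u hu => by
      have h := G.monotone_avgLaw η (hs.trans hu.1) (G.noise_le_noise_zero (sub_nonneg.mpr hu.2))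
      linarith
  have h := hanti (Set.left_mem_Icc.mpr hst) (Set.right_mem_Icc.mpr hst) hst
  simp only [Pi.add_apply, sub_self, heatSq_zero] at h
  linarith

theorem avgLaw_noise_sub_le {κ : ℝ} (hκ : 0 ≤ κ) {η : stdSimplex ℝ V} {s t : ℝ} (hs : 0 ≤ s)
    (hnoise : G.noise (t - s) ≤ (κ * Real.exp (-(2 * G.gap * (t - s)))) • G.noise 0) :
    G.avgLaw η s (G.noise (t - s)) + κ * (Real.exp (-(2 * G.gap * (t - s))) * (2 * G.gap) *
        G.avgLaw η s G.fluctSq + Real.exp (-(2 * G.gap * (t - s))) * -G.avgLaw η s (G.noise 0)) ≤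
      2 * κ * G.fluctSq η * (Real.exp (G.gap * s - 2 * G.gap * t) * G.gap) := by
  have hmono := G.monotone_avgLaw η hs hnoise
  rw [map_smul, smul_eq_mul] at hmono
  have hcoef : 0 ≤ κ * (Real.exp (-(2 * G.gap * (t - s))) * (2 * G.gap)) := by
    have := G.gap_nonneg
    positivity
  have hdecay := mul_le_mul_of_nonneg_left (G.avgLaw_fluctSq_le η hs) hcoef
  have hexp : Real.exp (G.gap * s - 2 * G.gap * t) =
      Real.exp (-(2 * G.gap * (t - s))) * Real.exp (-(G.gap * s)) := by
    rw [← Real.exp_add]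
    ring_nf
  rw [hexp]
  linarith

/- Adding `κ exp(-2γ(t-s)) w(s)`, where `w(s) = E ‖h_s‖₂²`, absorbs the noise. Since
`w(s) ≤ exp(-γs) w(0)`, what is left of the derivative is at most that of
`2κ exp(γs - 2γt) w(0)`. -/
theorem avgLaw_heatSq_add_le {b κ : ℝ} (hκ : 0 ≤ κ)
    (hnoise : ∀ r, b ≤ r → G.noise r ≤ (κ * Real.exp (-(2 * G.gap * r))) • G.noise 0)
    (η : stdSimplex ℝ V) {s t : ℝ} (hs : 0 ≤ s) (hst : s ≤ t - b) :
    G.avgLaw η s (G.heatSq (t - s)) +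
        κ * (Real.exp (-(2 * G.gap * (t - s))) * G.avgLaw η s G.fluctSq) -
        2 * κ * G.fluctSq η * Real.exp (G.gap * s - 2 * G.gap * t) ≤
      G.heatSq t η - κ * G.fluctSq η * Real.exp (-(2 * G.gap * t)) := by
  have hdecay : ∀ u, HasDerivAt (fun u => Real.exp (-(2 * G.gap * (t - u))))
      (Real.exp (-(2 * G.gap * (t - u))) * (2 * G.gap)) u := fun u =>
    ((((hasDerivAt_id u).const_sub t).const_mul (2 * G.gap)).neg).exp.congr_deriv (by simp)
  have hcompensator : ∀ u, HasDerivAt (fun u => Real.exp (G.gap * u - 2 * G.gap * t))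
      (Real.exp (G.gap * u - 2 * G.gap * t) * G.gap) u := fun u =>
    (((hasDerivAt_id u).const_mul G.gap).sub_const _).exp.congr_deriv (by simp)
  have hanti := antitoneOn_Icc_of_hasDerivAt_nonpos
    (fun u (_ : u ∈ Set.Icc 0 s) => ((G.hasDerivAt_avgLaw_heatSq η t u).add
      (((hdecay u).mul (G.hasDerivAt_avgLaw_fluctSq η u)).const_mul κ)).sub
        ((hcompensator u).const_mul (2 * κ * G.fluctSq η)))
    fun u hu => sub_nonpos.mpr
      (avgLaw_noise_sub_le hκ hu.1 (hnoise (t - u) (by linarith [hu.2])))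
  have h := hanti (Set.left_mem_Icc.mpr hs) (Set.right_mem_Icc.mpr hs) hs
  simp only [Pi.sub_apply, Pi.add_apply, Pi.mul_apply, sub_zero, mul_zero, zero_sub,
    avgLaw_zero] at h
  linarith

theorem avgLaw_heatSq_le {b κ : ℝ} (hb : 0 ≤ b) (hκ : 0 ≤ κ)
    (hnoise : ∀ r, b ≤ r → G.noise r ≤ (κ * Real.exp (-(2 * G.gap * r))) • G.noise 0)
    (η : stdSimplex ℝ V) {s t : ℝ} (hs : 0 ≤ s) (hst : s ≤ t - b) :
    G.avgLaw η s (G.heatSq (t - s)) ≤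
      (Real.exp (-(2 * G.gap * t)) + 2 * κ * Real.exp (-(G.gap * t))) * G.fluctSq η := by
  have hinit : G.heatSq t η ≤ Real.exp (-(2 * G.gap * t)) * G.fluctSq η := by
    rw [heatSq_apply, fluctSq_apply]
    exact normSq_heat_le (wtInner_one_fluct η) (by linarith)
  have hW : 0 ≤ G.fluctSq η := G.fluctSq_nonneg η
  have hend : 0 ≤ κ * (Real.exp (-(2 * G.gap * (t - s))) * G.avgLaw η s G.fluctSq) := by
    have := G.avgLaw_nonneg η hs G.fluctSq_nonneg
    positivity
  have hcomp : κ * G.fluctSq η * Real.exp (G.gap * s - 2 * G.gap * t) ≤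
      κ * G.fluctSq η * Real.exp (-(G.gap * t)) :=
    mul_le_mul_of_nonneg_left (Real.exp_le_exp.mpr (by
      linarith [mul_le_mul_of_nonneg_left (show s ≤ t by linarith) G.gap_nonneg])) (by positivity)
  have hpos : 0 ≤ κ * G.fluctSq η * Real.exp (-(2 * G.gap * t)) := by positivity
  linarith [avgLaw_heatSq_add_le hκ hnoise η hs hst]

theorem avgLaw_fluctSq_le_of_noise_le {b κ : ℝ} (hb : 0 < b) (hgb : G.gap * b ≤ 1 / 4)
    (hκ : 0 ≤ κ)
    (hnoise : ∀ r, b ≤ r → G.noise r ≤ (κ * Real.exp (-(2 * G.gap * r))) • G.noise 0)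
    (η : stdSimplex ℝ V) {t : ℝ} (ht : 0 ≤ t) :
    G.avgLaw η t G.fluctSq ≤
      3 * ((Real.exp (-(2 * G.gap * t)) + 2 * κ * Real.exp (-(G.gap * t))) * G.fluctSq η) := by
  have hW : 0 ≤ G.fluctSq η := G.fluctSq_nonneg η
  have hgap := G.gap_nonneg
  have hshift : ∀ c t : ℝ, c * (G.gap * b) ≤ 1 / 2 →
      Real.exp (-(c * (G.gap * (t - b)))) ≤ 5 / 3 * Real.exp (-(c * (G.gap * t))) := by
    intro c t hcb
    rw [show -(c * (G.gap * (t - b))) = c * (G.gap * b) + -(c * (G.gap * t)) by ring, Real.exp_add]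
    exact mul_le_mul_of_nonneg_right ((Real.exp_le_exp.mpr hcb).trans exp_half_le)
      (Real.exp_pos _).le
  refine le_mul_of_two_mul_le_add (f := fun t => G.avgLaw η t G.fluctSq)
    (g := fun t => (Real.exp (-(2 * G.gap * t)) + 2 * κ * Real.exp (-(G.gap * t))) * G.fluctSq η)
    (ρ := 5 / 3) hb (by norm_num) (by norm_num) (fun t _ => by positivity)
    (fun t _ => ?_) (fun t ht htb => ?_) (fun t htb => ?_) ht
  · have h2 := hshift 2 t (by linarith)
    have h1 := hshift 1 t (by linarith)
    simp only [one_mul, ← mul_assoc] at h1 h2 ⊢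
    refine mul_le_mul_of_nonneg_right ?_ hW
    linarith [mul_le_mul_of_nonneg_left h1 hκ]
  · have hgt : G.gap * t ≤ G.gap * b := mul_le_mul_of_nonneg_left htb.le hgap
    have hthird : 1 ≤ 3 * Real.exp (-(2 * G.gap * t)) := by
      linarith [Real.add_one_le_exp (-(2 * G.gap * t))]
    have hone : Real.exp (-(G.gap * t)) ≤ 1 :=
      Real.exp_le_one_iff.mpr (neg_nonpos.mpr (mul_nonneg hgap ht))
    have hpos : 0 ≤ κ * Real.exp (-(G.gap * t)) := by positivity
    simp only [← mul_assoc]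
    refine (G.avgLaw_fluctSq_le η ht).trans (mul_le_mul_of_nonneg_right ?_ hW)
    linarith
  · refine (two_mul_avgLaw_fluctSq_le η (sub_nonneg.mpr htb) (by linarith)).trans ?_
    gcongr
    exact avgLaw_heatSq_le hb.le hκ hnoise η (sub_nonneg.mpr htb) le_rfl

end Recursion

end Evolution

section Smoothing

variable {V : Type*} [Fintype V] {G : WeightedGraph V}

theorem lpNorm_one_fluct_add_one (η : stdSimplex ℝ V) : G.lpNorm 1 (G.fluct η + 1) = 1 := by
  have hx : ∀ x, G.wt x * |(G.fluct η + 1) x| ^ (1 : ℝ) = η.1 x := fun x => by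
    have hpos := G.wt_pos x
    rw [Real.rpow_one, Pi.add_apply, Pi.one_apply, fluct, sub_add_cancel,
      abs_of_nonneg (div_nonneg (η.2.1 x) hpos.le), mul_div_cancel₀ _ hpos.ne']
  rw [lpNorm, Finset.sum_congr rfl fun x _ => hx x, η.2.2, Real.one_rpow]

theorem normSq_fluct_add_one (η : stdSimplex ℝ V) :
    G.normSq (G.fluct η + 1) = G.fluctSq η + 1 := by
  rw [normSq_add, wtInner_comm, wtInner_one_fluct, ← wtInner_self 1, wtInner_one_one,
    fluctSq_apply, mul_zero, add_zero]

theorem Nash.rpow_fluctSq_add_one_le {d N T : ℝ} (h : G.Nash d N T) (η : stdSimplex ℝ V) :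
    (G.fluctSq η + 1) ^ (1 + 2 / d) ≤
      N * (G.dirichletForm (G.fluct η) + T⁻¹ * (G.fluctSq η + 1)) := by
  have hdensity := h (G.fluct η + 1)
  have hform : G.dirichletForm (G.fluct η + 1) = G.dirichletForm (G.fluct η) := by
    simpa using dirichletForm_add_smul_one (G := G) 1 (G.fluct η)
  rwa [lpNorm_one_fluct_add_one, Real.one_rpow, mul_one, lpNorm_two, hform,
    Real.sq_sqrt (normSq_nonneg _), Real.rpow_mul (Real.sqrt_nonneg _), Real.rpow_two,
    Real.sq_sqrt (normSq_nonneg _), normSq_fluct_add_one] at hdensity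

variable [DecidableEq V]

theorem avgLaw_fluctSq_add_one_rpow_le {A B α b : ℝ} (hB : 0 < B) (hα : 0 < α) (hb : 0 < b)
    (hNash : ∀ η, (G.fluctSq η + 1) ^ (1 + α) ≤
      B * G.dirichletForm (G.fluct η) + A * (G.fluctSq η + 1)) (η : stdSimplex ℝ V) :
    (G.avgLaw η b G.fluctSq + 1) ^ α ≤ max (2 * A) (2 * B / (α * b)) := by
  have hpos : ∀ s ∈ Set.Icc 0 b, 0 < G.avgLaw η s G.fluctSq + 1 := fun s hs =>
    add_pos_of_nonneg_of_pos (avgLaw_nonneg η hs.1 fluctSq_nonneg) one_pos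
  have hderiv : ∀ s ∈ Set.Icc 0 b, HasDerivAt (fun s => G.avgLaw η s G.fluctSq + 1)
      (-G.avgLaw η s (G.noise 0)) s := fun s _ => (hasDerivAt_avgLaw_fluctSq η s).add_const 1
  refine rpow_le_max_of_hasDerivAt_le hB hα hb hpos hderiv
    (antitoneOn_Icc_of_hasDerivAt_nonpos hderiv fun s hs =>
      neg_nonpos.mpr (avgLaw_nonneg η hs.1 (noise_nonneg 0))) fun s hs => ?_
  have hjensen := abs_rpow_le_of_monotone (G.monotone_avgLaw η hs.1) (avgLaw_one η s)
    (p := 1 + α) (by linarith) (f := G.fluctSq + 1)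
    (g := B • G.noise 0 + A • (G.fluctSq + 1)) fun ξ => by
      simp only [ContinuousMap.add_apply, ContinuousMap.smul_apply, ContinuousMap.one_apply,
        smul_eq_mul, noise_zero_apply]
      have hξ : 0 ≤ G.fluctSq ξ := G.fluctSq_nonneg ξ
      rw [abs_of_nonneg (by linarith)]
      exact hNash ξ
  rw [map_add, map_add, map_smul, map_smul, map_add, avgLaw_one, smul_eq_mul, smul_eq_mul,
    abs_of_pos (hpos s hs)] at hjensen
  linarith

theorem avgLaw_fluctSq_le_of_nash [Nontrivial V] {d N T D c₁ c₂ : ℝ} (hd : 0 < d) (hN : 0 < N)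
    (hNash : G.Nash d N T) (hD : d ≤ D) (hc₁ : N ≤ c₁ * G.tRel) (hc₂ : N * T⁻¹ ≤ c₂)
    (η : stdSimplex ℝ V) :
    G.avgLaw η (G.tRel / 4) G.fluctSq ≤ max (2 * c₂) (4 * c₁ * D) ^ (D / 2) := by
  have hτ := G.tRel_pos
  have hD0 : 0 < D := hd.trans_le hD
  have hnonneg : 0 ≤ G.avgLaw η (G.tRel / 4) G.fluctSq :=
    avgLaw_nonneg η (by positivity) fluctSq_nonneg
  have hsmooth := avgLaw_fluctSq_add_one_rpow_le (G := G) (A := c₂) (B := c₁ * G.tRel)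
    (α := 2 / D) (b := G.tRel / 4) (hN.trans_le hc₁) (by positivity) (by positivity)
    (fun ξ => ?_) η
  · rw [show 2 * (c₁ * G.tRel) / (2 / D * (G.tRel / 4)) = 4 * c₁ * D by field_simp]
      at hsmooth
    calc G.avgLaw η (G.tRel / 4) G.fluctSq
        ≤ ((G.avgLaw η (G.tRel / 4) G.fluctSq + 1) ^ (2 / D)) ^ (D / 2) := by
          rw [← Real.rpow_mul (by linarith), div_mul_div_cancel₀ hD0.ne', div_self two_ne_zero,
            Real.rpow_one]
          linarith
      _ ≤ max (2 * c₂) (4 * c₁ * D) ^ (D / 2) := by gcongr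
  · have hξ : 0 ≤ G.fluctSq ξ := G.fluctSq_nonneg ξ
    calc (G.fluctSq ξ + 1) ^ (1 + 2 / D)
        ≤ (G.fluctSq ξ + 1) ^ (1 + 2 / d) := by gcongr; exact le_add_of_nonneg_left hξ
      _ ≤ N * (G.dirichletForm (G.fluct ξ) + T⁻¹ * (G.fluctSq ξ + 1)) :=
          hNash.rpow_fluctSq_add_one_le ξ
      _ = N * G.dirichletForm (G.fluct ξ) + N * T⁻¹ * (G.fluctSq ξ + 1) := by ring
      _ ≤ c₁ * G.tRel * G.dirichletForm (G.fluct ξ) + c₂ * (G.fluctSq ξ + 1) := by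
          have := dirichletForm_nonneg (G := G) (G.fluct ξ)
          gcongr

end Smoothing

section CutoffWindow

variable {V : Type*} [Fintype V] {G : WeightedGraph V}

theorem lpNorm_fluct_le {p : ℝ} (hp : 0 < p) (hp2 : p ≤ 2) (η : stdSimplex ℝ V) :
    G.lpNorm p (G.fluct η) ≤ √(G.fluctSq η) := by
  rw [fluctSq_apply, ← lpNorm_two]
  exact lpNorm_mono hp hp2 _

theorem pairing_le_mul_lpDist {ψ : V → ℝ} {M : ℝ} (hM : ∀ x, |ψ x| ≤ M) {p : ℝ} (hp : 1 ≤ p) :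
    G.pairing ψ ≤ M • G.lpDist p (zero_le_one.trans hp) := ContinuousMap.le_def.mpr fun η => by
  obtain ⟨x₀⟩ := G.connected.nonempty
  have hM0 : 0 ≤ M := (abs_nonneg _).trans (hM x₀)
  calc G.wtInner ψ (G.fluct η)
      ≤ M * G.lpNorm 1 (G.fluct η) := by
        simp only [wtInner_apply, lpNorm, Real.rpow_one, div_one, Finset.mul_sum]
        refine Finset.sum_le_sum fun x _ => ?_
        rw [mul_left_comm M]
        refine mul_le_mul_of_nonneg_left ?_ (G.wt_pos x).le
        refine (le_abs_self _).trans ?_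
        rw [abs_mul]
        exact mul_le_mul_of_nonneg_right (hM x) (abs_nonneg _)
    _ ≤ M * G.lpNorm p (G.fluct η) :=
        mul_le_mul_of_nonneg_left (lpNorm_mono one_pos hp _) hM0

theorem pairing_sq_le {ψ : V → ℝ} (hψ : G.normSq ψ = 1) (η : stdSimplex ℝ V) :
    G.pairing ψ η ^ 2 ≤ G.fluctSq η := by
  have h := LinearMap.BilinForm.apply_sq_le_of_symm G.wtInner
    (fun φ => (normSq_nonneg φ).trans_eq (wtInner_self φ).symm) ⟨fun φ ψ => wtInner_comm φ ψ⟩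
    ψ (G.fluct η)
  rwa [wtInner_self, wtInner_self, hψ, one_mul, ← fluctSq_apply] at h

theorem exists_fluct_eq {φ : V → ℝ} (hmean : G.wtInner 1 φ = 0) (hφ : ∀ x, -1 ≤ φ x) :
    ∃ η, G.fluct η = φ := by
  refine ⟨⟨fun x => G.wt x * (1 + φ x), fun x => ?_, ?_⟩, funext fun x => ?_⟩
  · exact mul_nonneg (G.wt_pos x).le (by linarith [hφ x])
  · rw [wtInner_one_left] at hmean
    simp only [mul_add, mul_one, Finset.sum_add_distrib, G.sum_wt, hmean, add_zero]
  · simp only [fluct]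
    rw [mul_div_cancel_left₀ _ (G.wt_pos x).ne', add_sub_cancel_left]

variable [DecidableEq V]

section CutoffTime

theorem gap_mul_tRel [Nontrivial V] : G.gap * G.tRel = 1 :=
  mul_inv_cancel₀ gap_pos.ne'

theorem gap_mul_cutoffTime [Nontrivial V] (k : ℕ) (C : ℝ) :
    G.gap * G.cutoffTime k C = Real.log k / 2 + C := by
  rw [cutoffTime]
  linear_combination (Real.log k / 2 + C) * G.gap_mul_tRel

theorem cutoffTime_nonneg [Nontrivial V] {k : ℕ} {C : ℝ} (h : 0 ≤ Real.log k / 2 + C) :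
    0 ≤ G.cutoffTime k C :=
  nonneg_of_mul_nonneg_right (h.trans_eq (gap_mul_cutoffTime k C).symm) gap_pos

theorem sqrt_mul_exp_neg_gap_mul_cutoffTime [Nontrivial V] {k : ℕ} (hk : 1 ≤ k) (C : ℝ) :
    √k * Real.exp (-(G.gap * G.cutoffTime k C)) = Real.exp (-C) := by
  have hk0 : (0 : ℝ) < k := by exact_mod_cast hk
  rw [gap_mul_cutoffTime, neg_add, Real.exp_add, Real.exp_neg (Real.log k / 2), Real.exp_half,
    Real.exp_log hk0, mul_inv_cancel_left₀ (Real.sqrt_pos.mpr hk0).ne']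

end CutoffTime

section UpperBound

theorem avgWorstDist_le {p : ℝ} (hp : 1 ≤ p) (hp2 : p ≤ 2) {t B : ℝ} (ht : 0 ≤ t)
    (hB : ∀ η, G.avgLaw η t G.fluctSq ≤ B) :
    G.avgWorstDist p (zero_le_one.trans hp) t ≤ √B := by
  obtain ⟨x⟩ := G.connected.nonempty
  have : Nonempty (stdSimplex ℝ V) := ⟨⟨Pi.single x 1, single_mem_stdSimplex ℝ x⟩⟩
  refine ciSup_le fun η => Real.le_sqrt_of_sq_le ?_
  have hjensen := abs_rpow_le_of_monotone (G.monotone_avgLaw η ht) (avgLaw_one η t)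
    (p := 2) one_le_two (f := G.lpDist p (zero_le_one.trans hp)) (g := G.fluctSq) fun ξ => by
      rw [Real.rpow_two, sq_abs]
      exact (Real.le_sqrt (lpNorm_nonneg _ _) (fluctSq_nonneg ξ)).mp
        (lpNorm_fluct_le (one_pos.trans_le hp) hp2 ξ)
  rw [Real.rpow_two, sq_abs] at hjensen
  exact hjensen.trans (hB η)

theorem avgLaw_fluctSq_add_le {b K m : ℝ} (hb : 0 < b) (hgb : G.gap * b ≤ 1 / 4)
    (hK : ∀ η, G.avgLaw η b G.fluctSq ≤ K) (hm : ∀ x, G.wt x ≤ m) (η : stdSimplex ℝ V) {s : ℝ}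
    (hs : 0 ≤ s) :
    G.avgLaw η (b + s) G.fluctSq ≤
      3 * (Real.exp (-(2 * G.gap * s)) + 8 * K * m * Real.exp (-(G.gap * s))) * K := by
  obtain ⟨x⟩ := G.connected.nonempty
  have hm0 : 0 ≤ m := (G.wt_pos x).le.trans (hm x)
  have hK0 : 0 ≤ K := (avgLaw_nonneg η hb.le fluctSq_nonneg).trans (hK η)
  have hheat : ∀ ξ, G.normSq (G.heat b (G.fluct ξ)) ≤ K := fun ξ =>
    (normSq_heat_fluct_le_avgLaw ξ hb.le).trans (hK ξ)
  set c := 3 * (Real.exp (-(2 * G.gap * s)) + 8 * K * m * Real.exp (-(G.gap * s))) with hc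
  have hdecay : G.avgSemigroup s G.fluctSq ≤ c • G.fluctSq := ContinuousMap.le_def.mpr fun ξ =>
    (avgLaw_fluctSq_le_of_noise_le hb hgb (κ := 4 * K * m) (by positivity)
      (fun r hr => noise_le_exp_smul_noise_zero hgb hheat hm hr) ξ hs).trans_eq (by
        rw [ContinuousMap.smul_apply, smul_eq_mul, hc]
        ring)
  calc G.avgLaw η (b + s) G.fluctSq
      ≤ G.avgLaw η b (c • G.fluctSq) := by
        rw [avgLaw_add]
        exact G.monotone_avgLaw η hb.le hdecay
    _ ≤ c * K := by
        rw [map_smul, smul_eq_mul]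
        exact mul_le_mul_of_nonneg_left (hK η) (by positivity)

theorem sqrt_mul_exp_neg_gap_mul_cutoffTime_sub_le [Nontrivial V] {k : ℕ} (hk : 1 ≤ k) (C : ℝ) :
    √k * Real.exp (-(G.gap * (G.cutoffTime k C - G.tRel / 4))) ≤ 2 * Real.exp (-C) := by
  have hexp : Real.exp (1 / 4) ≤ 2 :=
    (Real.exp_le_exp.mpr (by norm_num)).trans (exp_half_le.trans (by norm_num))
  calc √k * Real.exp (-(G.gap * (G.cutoffTime k C - G.tRel / 4)))
      = Real.exp (1 / 4) * (√k * Real.exp (-(G.gap * G.cutoffTime k C))) := by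
        rw [mul_left_comm, ← Real.exp_add]
        congr 2
        linear_combination G.gap_mul_tRel / 4
    _ ≤ 2 * Real.exp (-C) := by
        rw [sqrt_mul_exp_neg_gap_mul_cutoffTime hk]
        gcongr

theorem mul_avgLaw_cutoffTime_le [Nontrivial V] {K q : ℝ}
    (hK : ∀ η, G.avgLaw η (G.tRel / 4) G.fluctSq ≤ K) {k : ℕ} (hk : 1 ≤ k)
    (hq : ∀ x, √k * G.wt x ≤ q) {C : ℝ} (hC : 1 ≤ C) (η : stdSimplex ℝ V) :
    k * G.avgLaw η (G.cutoffTime k C) G.fluctSq ≤ 12 * K * (1 + 4 * K * q) * Real.exp (-C) := by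
  obtain ⟨x⟩ := G.connected.nonempty
  have hq0 : 0 ≤ q := (mul_nonneg (Real.sqrt_nonneg _) (G.wt_pos x).le).trans (hq x)
  have hsqrt : 0 < √(k : ℝ) := Real.sqrt_pos.mpr (by exact_mod_cast hk)
  have hm : ∀ x, G.wt x ≤ q / √k := fun x => (le_div_iff₀' hsqrt).mpr (hq x)
  have hτ := G.tRel_pos
  have hK0 : 0 ≤ K := (avgLaw_nonneg η (by positivity) fluctSq_nonneg).trans (hK η)
  have hgτ : G.gap * (G.tRel / 4) ≤ 1 / 4 := by linarith [G.gap_mul_tRel]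
  set s := G.cutoffTime k C - G.tRel / 4 with hs
  have hs0 : 0 ≤ s := by
    have hlog : 0 ≤ Real.log k := Real.log_nonneg (by exact_mod_cast hk)
    rw [hs, cutoffTime]
    nlinarith
  set u := Real.exp (-(G.gap * s)) with hu
  have hdecay : √k * u ≤ 2 * Real.exp (-C) := sqrt_mul_exp_neg_gap_mul_cutoffTime_sub_le hk C
  have hsq : (√k * u) ^ 2 ≤ 4 * Real.exp (-C) := by
    have hexpC : Real.exp (-C) ≤ 1 := Real.exp_le_one_iff.mpr (by linarith)
    calc (√k * u) ^ 2 ≤ (2 * Real.exp (-C)) ^ 2 := by gcongr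
      _ ≤ 4 * Real.exp (-C) := by nlinarith [Real.exp_pos (-C)]
  have hsum := avgLaw_fluctSq_add_le (by positivity) hgτ hK hm η hs0
  rw [show -(2 * G.gap * s) = (2 : ℕ) * -(G.gap * s) by push_cast; ring, Real.exp_nat_mul, ← hu,
    hs, add_sub_cancel] at hsum
  calc k * G.avgLaw η (G.cutoffTime k C) G.fluctSq
      ≤ √k ^ 2 * (3 * (u ^ 2 + 8 * K * (q / √k) * u) * K) := by
        rw [Real.sq_sqrt k.cast_nonneg]
        gcongr
    _ = 3 * ((√k * u) ^ 2 + 8 * K * q * (√k * u)) * K := by field_simp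
    _ ≤ 3 * (4 * Real.exp (-C) + 8 * K * q * (2 * Real.exp (-C))) * K := by gcongr
    _ = 12 * K * (1 + 4 * K * q) * Real.exp (-C) := by ring

theorem sqrt_mul_avgWorstDist_cutoffTime_le [Nontrivial V] {K q : ℝ}
    (hK : ∀ η, G.avgLaw η (G.tRel / 4) G.fluctSq ≤ K) {k : ℕ} (hk : 1 ≤ k)
    (hq : ∀ x, √k * G.wt x ≤ q) {C : ℝ} (hC : 1 ≤ C) {p : ℝ} (hp : 1 ≤ p) (hp2 : p ≤ 2) :
    √k * G.avgWorstDist p (zero_le_one.trans hp) (G.cutoffTime k C) ≤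
      √(12 * K * (1 + 4 * K * q) * Real.exp (-C)) := by
  have hk0 : (0 : ℝ) < k := by exact_mod_cast hk
  have ht : 0 ≤ G.cutoffTime k C :=
    cutoffTime_nonneg (by linarith [Real.log_nonneg (Nat.one_le_cast.mpr hk : (1 : ℝ) ≤ k)])
  have hdist := avgWorstDist_le hp hp2 ht fun η =>
    (le_div_iff₀' hk0).mpr (mul_avgLaw_cutoffTime_le hK hk hq hC η)
  rwa [Real.sqrt_div' _ hk0.le, le_div_iff₀' (Real.sqrt_pos.mpr hk0)] at hdist

end UpperBound

section LowerBound

theorem le_avgWorstDist (p : ℝ) (hp : 0 ≤ p) (t : ℝ) (η : stdSimplex ℝ V) :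
    G.avgLaw η t (G.lpDist p hp) ≤ G.avgWorstDist p hp t :=
  le_ciSup (f := fun η => G.avgLaw η t (G.lpDist p hp))
    ⟨‖G.avgSemigroup t (G.lpDist p hp)‖, Set.forall_mem_range.mpr fun ξ =>
      (le_abs_self _).trans ((G.avgSemigroup t (G.lpDist p hp)).norm_coe_le_norm ξ)⟩ η

theorem avgLaw_pairing_of_eigenvector {ψ : V → ℝ} {μ : ℝ} (hψ : G.genCLM ψ = μ • ψ)
    (η : stdSimplex ℝ V) (t : ℝ) :
    G.avgLaw η t (G.pairing ψ) = Real.exp (t * μ) * G.pairing ψ η := by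
  have hsmul : G.pairing (μ • ψ) = μ • G.pairing ψ :=
    ContinuousMap.ext fun ξ => by simp [pairing]
  have hgen : G.avgGenerator (G.pairing ψ) = μ • G.pairing ψ := by
    rw [avgGenerator_pairing, hψ, hsmul]
  exact congrArg (· η) (expSemigroup_apply_of_eigenvector hgen t)

theorem pairing_single {ψ : V → ℝ} (hmean : G.wtInner 1 ψ = 0) (z : V) :
    G.pairing ψ ⟨Pi.single z 1, single_mem_stdSimplex ℝ z⟩ = ψ z := by
  have hfluct : G.fluct ⟨Pi.single z 1, single_mem_stdSimplex ℝ z⟩ =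
      Pi.single z (G.wt z)⁻¹ - 1 := by
    funext x
    rcases eq_or_ne x z with rfl | hx <;> simp [fluct, *]
  calc G.wtInner ψ (G.fluct ⟨Pi.single z 1, single_mem_stdSimplex ℝ z⟩)
      = G.wt z * (ψ z * (G.wt z)⁻¹) - 0 := by
        rw [hfluct, map_sub, wtInner_single, wtInner_comm ψ 1, hmean]
    _ = ψ z := by field_simp [(G.wt_pos z).ne']; ring

theorem sq_le_of_eigenvector {ψ : V → ℝ} (hψ : ψ ∈ G.unitMeanZero) {μ : ℝ}
    (hgen : G.genCLM ψ = μ • ψ) {b K : ℝ} (hb : 0 ≤ b)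
    (hK : ∀ η, G.avgLaw η b G.fluctSq ≤ K) (z : V) :
    Real.exp (2 * (b * μ)) * ψ z ^ 2 ≤ K := by
  set η : stdSimplex ℝ V := ⟨Pi.single z 1, single_mem_stdSimplex ℝ z⟩ with hη
  have hjensen := abs_rpow_le_of_monotone (G.monotone_avgLaw η hb) (avgLaw_one η b)
    (p := 2) one_le_two (f := G.pairing ψ) (g := G.fluctSq) fun ξ => by
      rw [Real.rpow_two, sq_abs]
      exact pairing_sq_le hψ.1 ξ
  rw [Real.rpow_two, sq_abs, avgLaw_pairing_of_eigenvector hgen, hη, pairing_single hψ.2,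
    mul_pow, ← Real.exp_nat_mul, Nat.cast_ofNat] at hjensen
  exact hjensen.trans (hK η)

theorem exp_mul_le_sq_mul_avgWorstDist {ψ : V → ℝ} (hmean : G.wtInner 1 ψ = 0)
    (hnorm : G.normSq ψ = 1) {μ : ℝ} (hgen : G.genCLM ψ = μ • ψ) {M : ℝ} (hM0 : 0 < M)
    (hM : ∀ x, |ψ x| ≤ M) {p : ℝ} (hp : 1 ≤ p) {t : ℝ} (ht : 0 ≤ t) :
    Real.exp (t * μ) ≤ M ^ 2 * G.avgWorstDist p (zero_le_one.trans hp) t := by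
  obtain ⟨η, hη⟩ : ∃ η, G.fluct η = M⁻¹ • ψ := by
    refine exists_fluct_eq (by rw [map_smul, hmean, smul_zero]) fun x => ?_
    rw [Pi.smul_apply, smul_eq_mul, inv_mul_eq_div, le_div_iff₀ hM0]
    linarith [(abs_le.mp (hM x)).1]
  have hstart : G.pairing ψ η = M⁻¹ :=
    (congrArg (G.wtInner ψ) hη).trans (by rw [map_smul, wtInner_self, hnorm, smul_eq_mul, mul_one])
  have h := G.monotone_avgLaw η ht (G.pairing_le_mul_lpDist hM hp)
  rw [map_smul, avgLaw_pairing_of_eigenvector hgen, hstart, ← div_eq_mul_inv, div_le_iff₀ hM0,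
    smul_eq_mul] at h
  calc Real.exp (t * μ) ≤ M ^ 2 * G.avgLaw η t (G.lpDist p (zero_le_one.trans hp)) :=
        h.trans_eq (by ring)
    _ ≤ M ^ 2 * G.avgWorstDist p (zero_le_one.trans hp) t := by
        gcongr
        exact le_avgWorstDist p _ t η

theorem exp_neg_gap_mul_le [Nontrivial V] {K : ℝ}
    (hK : ∀ η, G.avgLaw η (G.tRel / 4) G.fluctSq ≤ K) {p : ℝ} (hp : 1 ≤ p) {t : ℝ}
    (ht : 0 ≤ t) :
    Real.exp (-(G.gap * t)) ≤ 2 * K * G.avgWorstDist p (zero_le_one.trans hp) t := by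
  obtain ⟨ψ, hψ, hgen⟩ := G.exists_eigenfunction
  have hsup : ∀ z, ψ z ^ 2 ≤ 2 * K := fun z => by
    have hτ := G.tRel_pos
    have h := sq_le_of_eigenvector hψ hgen (by positivity) hK z
    have hexp : 1 / 2 ≤ Real.exp (2 * (G.tRel / 4 * -G.gap)) := by
      have hgτ : 2 * (G.tRel / 4 * -G.gap) = -(1 / 2) := by
        rw [tRel]
        field_simp [(gap_pos (G := G)).ne']
        norm_num
      linarith [Real.add_one_le_exp (2 * (G.tRel / 4 * -G.gap))]
    nlinarith [sq_nonneg (ψ z)]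
  have hK0 : 0 < 2 * K := by
    by_contra! hK0
    have hzero : ψ = 0 := funext fun z => pow_eq_zero_iff two_ne_zero |>.mp
      (((hsup z).trans hK0).antisymm (sq_nonneg _))
    simpa [hzero, normSq] using hψ.1
  have h := exp_mul_le_sq_mul_avgWorstDist hψ.2 hψ.1 hgen (Real.sqrt_pos.mpr hK0)
    (fun x => Real.abs_le_sqrt (hsup x)) hp ht
  rwa [Real.sq_sqrt hK0.le, mul_neg, mul_comm t] at h

theorem exp_le_mul_sqrt_mul_avgWorstDist [Nontrivial V] {K : ℝ}
    (hK : ∀ η, G.avgLaw η (G.tRel / 4) G.fluctSq ≤ K) {k : ℕ} (hk : 1 ≤ k) {C : ℝ}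
    (hC : 2 * C ≤ Real.log k) {p : ℝ} (hp : 1 ≤ p) :
    Real.exp C ≤
      2 * K * (√k * G.avgWorstDist p (zero_le_one.trans hp) (G.cutoffTime k (-C))) := by
  have hgap := exp_neg_gap_mul_le hK hp (G.cutoffTime_nonneg (k := k) (C := -C) (by linarith))
  calc Real.exp C = √k * Real.exp (-(G.gap * G.cutoffTime k (-C))) := by
        rw [sqrt_mul_exp_neg_gap_mul_cutoffTime hk, neg_neg]
    _ ≤ √k * (2 * K * G.avgWorstDist p (zero_le_one.trans hp) (G.cutoffTime k (-C))) := by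
        gcongr
    _ = _ := mul_left_comm _ _ _

end LowerBound

end CutoffWindow

end WeightedGraph

end

section Asymptotics

variable {V : ℕ+ → Type*} [∀ n, Fintype (V n)] {G : ∀ n, WeightedGraph (V n)}

theorem UniformlyElliptic.exists_eventually_sqrt_mul_wt_le
    (hV : ∀ n, Fintype.card (V n) = n) (hEll : UniformlyElliptic G) {k : ℕ+ → ℕ}
    (hkVol : (fun n => (k n : ℝ)) =O[atTop] fun n => (n : ℝ) ^ 2) :
    ∃ q : ℝ, ∀ᶠ n in atTop, ∀ x, √(k n) * (G n).wt x ≤ q := by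
  obtain ⟨cEll, -, hEll⟩ := hEll
  obtain ⟨c, hc, hkVol⟩ := hkVol.exists_pos
  refine ⟨√c * cEll, hkVol.bound.mono fun n hn x => ?_⟩
  have hsqrt : √(k n) ≤ √c * n := by
    rw [RCLike.norm_natCast, norm_pow, RCLike.norm_natCast] at hn
    exact (Real.sqrt_le_sqrt hn).trans_eq
      (by rw [Real.sqrt_mul hc.le, Real.sqrt_sq n.val.cast_nonneg])
  have hwt : n * (G n).wt x ≤ cEll :=
    calc (n : ℝ) * (G n).wt x = ∑ _y : V n, (G n).wt x := by
          rw [Finset.sum_const, Finset.card_univ, hV, nsmul_eq_mul]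
      _ ≤ ∑ y, cEll * (G n).wt y := Finset.sum_le_sum fun y _ => hEll n x y
      _ = cEll := by rw [← Finset.mul_sum, (G n).sum_wt, mul_one]
  calc √(k n) * (G n).wt x ≤ √c * n * (G n).wt x :=
        mul_le_mul_of_nonneg_right hsqrt ((G n).wt_pos x).le
    _ ≤ √c * cEll := by rw [mul_assoc]; gcongr

theorem WeightedGraph.nontrivial_of_wt_lt_one {V : Type*} [Fintype V] {G : WeightedGraph V}
    (h : ∀ x, G.wt x < 1) : Nontrivial V := by
  by_contra hV
  rw [not_nontrivial_iff_subsingleton] at hV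
  obtain ⟨x⟩ := G.connected.nonempty
  have hsum := G.sum_wt
  rw [Fintype.sum_subsingleton _ x] at hsum
  exact (h x).ne hsum

theorem eventually_nontrivial_of_sqrt_mul_wt_le {k : ℕ+ → ℕ} (hk : Tendsto k atTop atTop)
    {q : ℝ} (hq : ∀ᶠ n in atTop, ∀ x, √(k n) * (G n).wt x ≤ q) :
    ∀ᶠ n in atTop, Nontrivial (V n) := by
  have hsqrt : Tendsto (fun n => √(k n : ℝ)) atTop atTop :=
    Real.tendsto_sqrt_atTop.comp (tendsto_natCast_atTop_atTop.comp hk)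
  filter_upwards [hq, hsqrt.eventually_gt_atTop q] with n hn hkn
  refine (G n).nontrivial_of_wt_lt_one fun x => lt_of_mul_lt_mul_left ?_ (Real.sqrt_nonneg (k n))
  exact ((hn x).trans_lt hkn).trans_eq (mul_one _).symm

variable [∀ n, DecidableEq (V n)]

theorem FiniteDimensionalGeometry.exists_eventually_avgLaw_fluctSq_le
    (hNash : FiniteDimensionalGeometry G) (hV : ∀ᶠ n in atTop, Nontrivial (V n)) :
    ∃ K : ℝ, 0 < K ∧ ∀ᶠ n in atTop, ∀ η,
      (G n).avgLaw η ((G n).tRel / 4) (G n).fluctSq ≤ K := by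
  obtain ⟨d, N, T, h, hd, hN, hT⟩ := hNash
  obtain ⟨D, -, hD⟩ := hd.exists_pos
  obtain ⟨c₁, -, hN⟩ := hN.exists_pos
  obtain ⟨c₂, hc₂, hT⟩ := hT.2.exists_pos
  refine ⟨max (2 * c₂) (4 * c₁ * D) ^ (D / 2), Real.rpow_pos_of_pos
    (lt_max_of_lt_left (by positivity)) _, ?_⟩
  filter_upwards [hD.bound, hN.bound, hT.bound, hV] with n hDn hNn hTn hVn
  obtain ⟨hd0, hN0, hT0, hNashn⟩ := h n
  rw [Real.norm_of_nonneg hd0.le, norm_one, mul_one] at hDn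
  rw [Real.norm_of_nonneg hN0.le, Real.norm_of_nonneg (G n).tRel_pos.le] at hNn
  rw [Real.norm_of_nonneg hN0.le, Real.norm_of_nonneg hT0.le] at hTn
  exact (G n).avgLaw_fluctSq_le_of_nash hd0 hN0 hNashn hDn hNn
    (by rwa [← div_eq_mul_inv, div_le_iff₀ hT0])

theorem mainTheorem3_general (hNash : FiniteDimensionalGeometry G) (k : ℕ+ → ℕ)
    (hk : Tendsto k atTop atTop)
    (hwt : ∃ q : ℝ, ∀ᶠ n in atTop, ∀ x, √(k n) * (G n).wt x ≤ q) :
    ∀ δ : ℝ, 0 < δ → ∃ C : ℝ, 0 < C ∧ ∀ (p : ℝ) (hp : 1 ≤ p), p ≤ 2 →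
      limsup (fun n => ((√(k n) * (G n).avgWorstDist p (zero_le_one.trans hp)
        ((G n).cutoffTime (k n) C) : ℝ) : EReal)) atTop ≤ (δ : EReal) ∧
      ((1 / δ : ℝ) : EReal) ≤
        liminf (fun n => ((√(k n) * (G n).avgWorstDist p (zero_le_one.trans hp)
          ((G n).cutoffTime (k n) (-C)) : ℝ) : EReal)) atTop := by
  intro δ hδ
  obtain ⟨q, hq⟩ := hwt
  have hV := eventually_nontrivial_of_sqrt_mul_wt_le hk hq
  obtain ⟨K, hK0, hK⟩ := hNash.exists_eventually_avgLaw_fluctSq_le hV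
  have hk1 : ∀ᶠ n in atTop, 1 ≤ k n := hk.eventually_ge_atTop 1
  have hupper : ∀ᶠ C in atTop, √(12 * K * (1 + 4 * K * q) * Real.exp (-C)) ≤ δ := by
    refine Tendsto.eventually_le_const hδ ?_
    simpa using (Real.tendsto_exp_neg_atTop_nhds_zero.const_mul (12 * K * (1 + 4 * K * q))).sqrt
  have hlower : ∀ᶠ C in atTop, 2 * K * (1 / δ) ≤ Real.exp C :=
    Real.tendsto_exp_atTop.eventually_ge_atTop _
  obtain ⟨C, hC1, hCδ, hCK⟩ := ((eventually_ge_atTop 1).and (hupper.and hlower)).exists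
  have hlog : ∀ᶠ n in atTop, 2 * C ≤ Real.log (k n) :=
    (Real.tendsto_log_atTop.comp (tendsto_natCast_atTop_atTop.comp hk)).eventually_ge_atTop _
  refine ⟨C, one_pos.trans_le hC1, fun p hp hp2 =>
    ⟨limsup_le_of_le (by isBoundedDefault) ?_, le_liminf_of_le (by isBoundedDefault) ?_⟩⟩
  · filter_upwards [hV, hK, hk1, hq] with n _ hKn hkn hqn
    exact EReal.coe_le_coe ((WeightedGraph.sqrt_mul_avgWorstDist_cutoffTime_le hKn hkn hqn hC1
      hp hp2).trans hCδ)
  · filter_upwards [hV, hK, hk1, hlog] with n _ hKn hkn hlogn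
    exact EReal.coe_le_coe (le_of_mul_le_mul_left (hCK.trans
      (WeightedGraph.exp_le_mul_sqrt_mul_avgWorstDist hKn hkn hlogn hp)) (by positivity))

end Asymptotics

theorem mainTheorem3 {V : ℕ+ → Type*} [∀ n, Fintype (V n)] [∀ n, DecidableEq (V n)]
    (hV : ∀ n, Fintype.card (V n) = n) (G : ∀ n, WeightedGraph (V n))
    (hNash : FiniteDimensionalGeometry G) (hEll : UniformlyElliptic G)
    (k : ℕ+ → ℕ) (hk : Tendsto k atTop atTop)
    (hkVol : (fun n => (k n : ℝ)) =O[atTop] fun n => (n : ℝ) ^ 2) :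
    ∀ δ : ℝ, 0 < δ → δ < 1 → ∃ C : ℝ, 0 < C ∧ ∀ (p : ℝ) (hp : 1 ≤ p), p ≤ 2 →
      limsup (fun n => ((√(k n) * (G n).avgWorstDist p (zero_le_one.trans hp)
        ((G n).cutoffTime (k n) C) : ℝ) : EReal)) atTop ≤ (δ : EReal) ∧
      ((1 / δ : ℝ) : EReal) ≤
        liminf (fun n => ((√(k n) * (G n).avgWorstDist p (zero_le_one.trans hp)
          ((G n).cutoffTime (k n) (-C)) : ℝ) : EReal)) atTop :=
  fun δ hδ _ => mainTheorem3_general hNash k hk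
    (hEll.exists_eventually_sqrt_mul_wt_le hV hkVol) δ hδ
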